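/- Let $H$ be a separable complex Hilbert space and let $\alpha\in C^{2}[0,1]$, $\alpha\ge 0$, have a zero set of Lebesgue measure $0$. Let $L^2_\alpha=L^2_\alpha(H,(0,1))$ be the Hilbert space of $H$-valued functions with norm $\|u\|^2=\int_0^1\|u(t)\|^2\alpha(t)\,dt$. Let $A(t)=A_r(t)+iA_i(t)$, $t\in[0,1]$, be densely defined closed operators in $H$ with a dense domain $D$ independent of $t$, where $A_r(t)$ and $A_i(t)$ are self-adjoint and commute strongly (that is, their resolvents commute). Suppose that for every $f\in D$ the function $A_i(t)f$ is continuously differentiable on $[0,1]$ and $A_r(t)f$ is continuously differentiable on $(0,1)$, and that $$A_r(t)=\frac{\alpha'(t)}{2\alpha(t)}I+C\quad\text{for a.e. }t\in(0,1)$$ with a constant self-adjoint operator $C\ge 0$. Let $U(t,s)$, $t,s\in[0,1]$, be the (bounded) evolution operators of $\partial_tU(t,s)f+iA_i(t)U(t,s)f=0$, $U(s,s)f=f$ for $f\in D$. Let $L_0$ and $L_0^+$ be the minimal operators of $l(u)=u'+A(t)u$ and $l^+(v)=-(\alpha v)'/\alpha+A(t)^*v$ in $L^2_\alpha$, that is,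 the closures of $l$ and $l^+$ on the finite sums $\sum_k\varphi_kf_k$ with $\varphi_k\in C_0^\infty(0,1)$, $f_k\in D$; let $L=(L_0^+)^*$ and $L^+=L_0^*$. For a unitary operator $W$ in $H$ with $CW=WC$ let $L_W$ be the restriction of $L$ to those $u\in D(L)\cap D(L^+)$ that satisfy $$(\sqrt\alpha\,u)(1)=U(1,0)\,W\,(\sqrt\alpha\,u)(0).$$ An operator $N$ is called normal if it is densely defined and closed, $D(N)=D(N^*)$, and $\|Nu\|=\|N^*u\|$ for $u\in D(N)$. Suppose that $C$ has a compact inverse $C^{-1}$ and that $L_W$ is a normal extension of $L_0$. Then the eigenvalues of $C$ can be listed, repeated according to multiplicity, in increasing order as $(\lambda_n(C))_n$, and those of $W^*e^{-C}$, repeated according to multiplicity, in order of decreasing modulus as $(\lambda_n(W^*e^{-C}))_n$ (with $n$ running through $\mathbb N$ if $\dim H=\infty$, and through $\dim H$ values otherwise), and for any such lists $$\sigma(L_W)=\left\{\lambda_n(C)-i\left(\arg\lambda_n(W^*e^{-C})+2k\pi\right)\;:\;n\in I,\ k\in\mathbb Z\right\},$$ where $I$ is the common index set of the two lists. -/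

import Mathlib

open MeasureTheory Set Filter Topology
open scoped LinearPMap ContDiff

noncomputable section

namespace WeightedNormal

section Operators

variable {E : Type*} [NormedAddCommGroup E] [InnerProductSpace ℂ E]

open scoped Classical in
/-- The value `T x` of a partially defined operator, with the value `0` outside the domain. -/
def app (T : E →ₗ.[ℂ] E) (x : E) : E :=
  if h : x ∈ T.domain then T ⟨x, h⟩ else 0

/-- The everywhere defined bounded operator `R` is the resolvent `(T - z)⁻¹` of the possibly
unbounded operator `T`: it is a two-sided inverse of `T - z : D(T) → E`. For `z = 0` this says
`R = T⁻¹`. -/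
def IsResolventAt (T : E →ₗ.[ℂ] E) (z : ℂ) (R : E →L[ℂ] E) : Prop :=
  (∀ y : E, ∃ h : R y ∈ T.domain, T ⟨R y, h⟩ - z • R y = y) ∧
    ∀ x : T.domain, R (T x - z • (x : E)) = x

/-- The spectrum of a possibly unbounded operator. -/
def pmapSpectrum (T : E →ₗ.[ℂ] E) : Set ℂ :=
  {z | ¬ ∃ R : E →L[ℂ] E, IsResolventAt T z R}

/-- The bounded operator `B` commutes with the possibly unbounded operator `T`: `B T ⊆ T B`. -/
def CommutesWith (B : E →L[ℂ] E) (T : E →ₗ.[ℂ] E) : Prop :=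
  ∀ x : T.domain, ∃ h : B x ∈ T.domain, T ⟨B x, h⟩ = B (T x)

/-- Commutation of two possibly unbounded self-adjoint operators: all the resolvents of `S`
commute with `T` (equivalently, the spectral projections commute). -/
def StronglyCommute (S T : E →ₗ.[ℂ] E) : Prop :=
  ∀ (z : ℂ) (R : E →L[ℂ] E), IsResolventAt S z R → CommutesWith R T

variable [CompleteSpace E]

/-- A densely defined closed operator `N` is formally normal if `D(N) ⊆ D(N*)` and
`‖N u‖ = ‖N* u‖` for all `u ∈ D(N)`. -/
structure IsFormallyNormal (N : E →ₗ.[ℂ] E) : Prop where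
  dense : Dense (N.domain : Set E)
  closed : N.IsClosed
  domain_le : N.domain ≤ N†.domain
  norm_eq : ∀ (x : N.domain) (y : N†.domain), (x : E) = y → ‖N x‖ = ‖N† y‖

/-- A formally normal operator is normal if `D(N) = D(N*)`. -/
structure IsNormal (N : E →ₗ.[ℂ] E) : Prop extends IsFormallyNormal N where
  domain_eq : N.domain = N†.domain

/-- `N` is a normal extension of `T`. -/
def IsNormalExtension (T N : E →ₗ.[ℂ] E) : Prop :=
  T ≤ N ∧ IsNormal N

/-- The eigenspace `{x ∈ D(T) : T x = z x}`. -/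
def pmapEigenspace (T : E →ₗ.[ℂ] E) (z : ℂ) : Submodule ℂ E where
  carrier := {x | ∃ h : x ∈ T.domain, T ⟨x, h⟩ = z • x}
  zero_mem' := ⟨T.domain.zero_mem, by
    rw [smul_zero]; exact T.map_zero⟩
  add_mem' := by
    rintro x y ⟨hx, ex⟩ ⟨hy, ey⟩
    refine ⟨T.domain.add_mem hx hy, ?_⟩
    have := T.map_add ⟨x, hx⟩ ⟨y, hy⟩
    rw [ex, ey] at this
    rw [smul_add]; exact this
  smul_mem' := by
    rintro c x ⟨hx, ex⟩
    refine ⟨T.domain.smul_mem c hx, ?_⟩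
    have := T.map_smul c ⟨x, hx⟩
    rw [ex] at this
    rw [smul_comm]; exact this

/-- The indices `n` of the eigenvalues: all `n ∈ ℕ` if `E` has infinite dimension, and
`n < dim E` otherwise. -/
def eigenIndex (E : Type*) [NormedAddCommGroup E] [InnerProductSpace ℂ E] : Set ℕ :=
  {n | (n : Cardinal) < Module.rank ℂ E}

/-- The sequence `e n`, `n ∈ eigenIndex E`, lists the eigenvalues of `T`, each of them repeated
according to its multiplicity. -/
def IsEigenvalueSequence (T : E →ₗ.[ℂ] E) (e : ℕ → ℂ) : Prop :=
  ∀ z : ℂ, {n | n ∈ eigenIndex E ∧ e n = z}.encard =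
    Cardinal.toENat (Module.rank ℂ (pmapEigenspace T z))

/-- A bounded operator, viewed as an operator with domain the whole space. -/
def ofBounded (B : E →L[ℂ] E) : E →ₗ.[ℂ] E :=
  (B : E →ₗ[ℂ] E).toPMap ⊤

/-- The operator `exp (-C)` of a nonnegative self-adjoint operator `C` with bounded inverse
`Cinv = C⁻¹`, through the continuous functional calculus: `expNegInvGlue x` is `exp (-1 / x)` for
`x > 0` and `0` for `x ≤ 0`, so this is `exp (-(C⁻¹)⁻¹)`. -/
def expNeg (Cinv : E →L[ℂ] E) : E →L[ℂ] E :=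
  cfc expNegInvGlue Cinv

end Operators

section Differential

variable {H : Type*} [NormedAddCommGroup H] [InnerProductSpace ℂ H] [CompleteSpace H]

/-- The measure `α(t) dt` on `(0, 1)`. -/
def weightedMeasure (α : ℝ → ℝ) : Measure ℝ :=
  (volume.restrict (Ioo 0 1)).withDensity fun t => ENNReal.ofReal (α t)

variable (H) in
/-- The weighted Hilbert space `L²_α(H, (0, 1))`. -/
abbrev WeightedL2 (α : ℝ → ℝ) : Type _ := Lp H 2 (weightedMeasure α)

/-- Scalar test functions: `φ ∈ C₀^∞(0, 1)`. -/
def IsTestFunction (φ : ℝ → ℂ) : Prop :=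
  ContDiff ℝ ∞ φ ∧ HasCompactSupport φ ∧ tsupport φ ⊆ Ioo 0 1

/-- The graph of `l(u) = u' + A(t) u` on the finite sums `u = ∑ φ_k f_k` with
`φ_k ∈ C₀^∞(0, 1)` and `f_k ∈ D`. -/
def preMinimalGraph (α : ℝ → ℝ) (D : Submodule ℂ H) (A : ℝ → H →ₗ.[ℂ] H) :
    Submodule ℂ (WeightedL2 H α × WeightedL2 H α) :=
  Submodule.span ℂ {p | ∃ (φ : ℝ → ℂ) (f : H), IsTestFunction φ ∧ f ∈ D ∧
    (∀ᵐ t ∂weightedMeasure α, p.1 t = φ t • f) ∧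
    (∀ᵐ t ∂weightedMeasure α, p.2 t = deriv φ t • f + φ t • app (A t) f)}

/-- The graph of the formally adjoint expression `l⁺(v) = -(α v)' / α + A(t)* v` on the finite
sums `v = ∑ φ_k f_k` with `φ_k ∈ C₀^∞(0, 1)` and `f_k ∈ D`; here `D = D(A(t)) = D(A(t)*)`, since
`A(t)` is normal. -/
def preMinimalPlusGraph (α : ℝ → ℝ) (D : Submodule ℂ H) (A : ℝ → H →ₗ.[ℂ] H) :
    Submodule ℂ (WeightedL2 H α × WeightedL2 H α) :=
  Submodule.span ℂ {p | ∃ (φ : ℝ → ℂ) (f : H), IsTestFunction φ ∧ f ∈ D ∧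
    (∀ᵐ t ∂weightedMeasure α, p.1 t = φ t • f) ∧
    (∀ᵐ t ∂weightedMeasure α, p.2 t =
      -((deriv (fun s => (α s : ℂ) * φ s) t / (α t : ℂ)) • f) + φ t • app (A t)† f)}

/-- The minimal operator `L₀`: the closure of `l` on the sums above. -/
def minimalOp (α : ℝ → ℝ) (D : Submodule ℂ H) (A : ℝ → H →ₗ.[ℂ] H) :
    WeightedL2 H α →ₗ.[ℂ] WeightedL2 H α :=
  (preMinimalGraph α D A).toLinearPMap.closure

/-- The minimal operator `L₀⁺` of the formally adjoint expression. -/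
def minimalOpPlus (α : ℝ → ℝ) (D : Submodule ℂ H) (A : ℝ → H →ₗ.[ℂ] H) :
    WeightedL2 H α →ₗ.[ℂ] WeightedL2 H α :=
  (preMinimalPlusGraph α D A).toLinearPMap.closure

/-- The maximal operator `L = (L₀⁺)*`. -/
def maximalOp (α : ℝ → ℝ) (D : Submodule ℂ H) (A : ℝ → H →ₗ.[ℂ] H) :
    WeightedL2 H α →ₗ.[ℂ] WeightedL2 H α :=
  (minimalOpPlus α D A)†

/-- The maximal operator `L⁺ = (L₀)*`. -/
def maximalOpPlus (α : ℝ → ℝ) (D : Submodule ℂ H) (A : ℝ → H →ₗ.[ℂ] H) :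
    WeightedL2 H α →ₗ.[ℂ] WeightedL2 H α :=
  (minimalOp α D A)†

/-- `√α u` has (a representative with) the boundary values `x₀` at `0` and `x₁` at `1`. -/
def HasBoundaryValues (α : ℝ → ℝ) (u : WeightedL2 H α) (x₀ x₁ : H) : Prop :=
  ∃ w : ℝ → H, (∀ᵐ t ∂weightedMeasure α, w t = ((√(α t) : ℝ) : ℂ) • u t) ∧
    Tendsto w (𝓝[>] 0) (𝓝 x₀) ∧ Tendsto w (𝓝[<] 1) (𝓝 x₁)

/-- The boundary condition `(√α u)(1) = V (√α u)(0)`. -/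
def boundaryCondition (α : ℝ → ℝ) (V : H →L[ℂ] H) : Submodule ℂ (WeightedL2 H α) where
  carrier := {u | ∃ x₀ x₁ : H, HasBoundaryValues α u x₀ x₁ ∧ x₁ = V x₀}
  zero_mem' := by
    refine ⟨0, 0, ⟨fun _ => 0, ?_, tendsto_const_nhds, tendsto_const_nhds⟩, by simp⟩
    filter_upwards [Lp.coeFn_zero H 2 (weightedMeasure α)] with t ht
    rw [ht]; simp
  add_mem' := by
    rintro u v ⟨x₀, x₁, ⟨w, hw, h0, h1⟩, hx⟩ ⟨y₀, y₁, ⟨z, hz, k0, k1⟩, hy⟩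
    refine ⟨x₀ + y₀, x₁ + y₁, ⟨fun t => w t + z t, ?_, h0.add k0, h1.add k1⟩, by
      rw [hx, hy, map_add]⟩
    filter_upwards [hw, hz, Lp.coeFn_add u v] with t h1 h2 h3
    rw [h1, h2, h3, Pi.add_apply, smul_add]
  smul_mem' := by
    rintro c u ⟨x₀, x₁, ⟨w, hw, h0, h1⟩, hx⟩
    refine ⟨c • x₀, c • x₁, ⟨fun t => c • w t, ?_, h0.const_smul c, h1.const_smul c⟩, by
      rw [hx, map_smul]⟩
    filter_upwards [hw, Lp.coeFn_smul c u] with t h1 h2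
    rw [h1, h2, Pi.smul_apply, smul_comm]

/-- The operator `L_W` (with `V = U(1, 0) W`): the restriction of the maximal operator `L` to
the `u ∈ D(L) ∩ D(L⁺)` with `(√α u)(1) = V (√α u)(0)`. -/
def boundaryOp (α : ℝ → ℝ) (D : Submodule ℂ H) (A : ℝ → H →ₗ.[ℂ] H) (V : H →L[ℂ] H) :
    WeightedL2 H α →ₗ.[ℂ] WeightedL2 H α :=
  (maximalOp α D A).domRestrict ((maximalOpPlus α D A).domain ⊓ boundaryCondition α V)

/-- The standing assumptions on the weight `α` and on the coefficient
`A(t) = A_r(t) + i A_i(t)` with constant domain `D`, including the normality condition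
`A_r(t) = α'(t) / (2 α(t)) + C`, with a constant operator `C ≥ 0`. -/
structure StandingAssumptions (α : ℝ → ℝ) (D : Submodule ℂ H) (A Ar Ai : ℝ → H →ₗ.[ℂ] H)
    (C : H →ₗ.[ℂ] H) : Prop where
  weight_contDiff : ContDiffOn ℝ 2 α (Icc 0 1)
  weight_nonneg : ∀ t ∈ Icc (0 : ℝ) 1, 0 ≤ α t
  weight_zeros : volume {t | t ∈ Icc (0 : ℝ) 1 ∧ α t = 0} = 0
  dense : Dense (D : Set H)
  domain_eq : ∀ t ∈ Icc (0 : ℝ) 1, (A t).domain = D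
  closed : ∀ t ∈ Icc (0 : ℝ) 1, (A t).IsClosed
  decomposition : ∀ t ∈ Icc (0 : ℝ) 1, A t = Ar t + Complex.I • Ai t
  real_selfAdjoint : ∀ t ∈ Icc (0 : ℝ) 1, IsSelfAdjoint (Ar t)
  imag_selfAdjoint : ∀ t ∈ Icc (0 : ℝ) 1, IsSelfAdjoint (Ai t)
  commute : ∀ t ∈ Icc (0 : ℝ) 1, StronglyCommute (Ar t) (Ai t)
  real_smooth : ∀ f ∈ D, ContDiffOn ℝ 1 (fun t => app (Ar t) f) (Ioo 0 1)
  imag_smooth : ∀ f ∈ D, ContDiffOn ℝ 1 (fun t => app (Ai t) f) (Icc 0 1)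
  const_selfAdjoint : IsSelfAdjoint C
  const_nonneg : ∀ x : C.domain, 0 ≤ (inner ℂ (C x) (x : H)).re
  normality : ∀ᵐ t ∂volume.restrict (Ioo (0 : ℝ) 1),
    Ar t = (((deriv α t / (2 * α t) : ℝ) : ℂ) • (LinearMap.id : H →ₗ[ℂ] H)) +ᵥ C

/-- `U(t, s)`, `t, s ∈ [0, 1]`, is the family of evolution operators of the equation
`U_t'(t, s) f + i A_i(t) U(t, s) f = 0`, `U(s, s) f = f`, for `f ∈ D`. -/
structure IsEvolutionFamily (D : Submodule ℂ H) (Ai : ℝ → H →ₗ.[ℂ] H)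
    (U : ℝ → ℝ → H →L[ℂ] H) : Prop where
  initial : ∀ s ∈ Icc (0 : ℝ) 1, ∀ f ∈ D, U s s f = f
  mem_domain : ∀ t ∈ Icc (0 : ℝ) 1, ∀ s ∈ Icc (0 : ℝ) 1, ∀ f ∈ D, U t s f ∈ (Ai t).domain
  equation : ∀ t ∈ Icc (0 : ℝ) 1, ∀ s ∈ Icc (0 : ℝ) 1, ∀ f ∈ D,
    HasDerivWithinAt (fun r => U r s f) (-(Complex.I • app (Ai t) (U t s f))) (Icc 0 1) t

end Differential

end WeightedNormal

end

open WeightedNormal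

open scoped InnerProductSpace

noncomputable section

namespace WeightedNormal

/-! ### Resolvents and spectra of unbounded normal operators -/

section NormalOperators

variable {E : Type*} [NormedAddCommGroup E] [InnerProductSpace ℂ E]

/-! Multiplication by `√α` carries the weighted space onto the unweighted one and absorbs the term
`α'/(2α)`, so that `l` becomes `w' + i A_i(t) w + C w`: a skew-symmetric part plus the constant
symmetric part `C`. The resolvent `C⁻¹` is compact and commutes with `W`, so
`exists_joint_eigenbasis` gives a Hilbert basis `b i` with `C (b i) = λ_i b i`, `W (b i) = ζ_i b i`
and `|ζ_i| = 1`.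

Strong commutation makes the evolution preserve the finite-dimensional eigenspaces of `C`
(`StandingAssumptions.evolution_mem_eigenspace`). Hence `w(t) = exp(iθt) U(t,0) b i`, with `θ = arg
ζ_i + 2πk`, solves `w' + i A_i w + C w = (λ_i + iθ) w`, and `exp(iθ) = ζ_i` is exactly the boundary
condition. So `w/√α` is an eigenvector of `L_W` (`boundaryOp_modeLp`). These functions are
orthonormal, and they are total by Fourier series in `t` (`modeLp_total`).

A normal operator with a Hilbert basis of eigenvectors has no spectrum at positive distance from its
eigenvalues (`IsNormal.not_mem_pmapSpectrum`). Here the points `λ_i + iθ` do not accumulate, because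
`λ_i → ∞` when there are infinitely many and each vertical line carries 2π-spaced points
(`exists_dist_eigenvalue_pos`). The spectrum is therefore the set of these points.

To reach the stated form, note that `W* exp(-C)` has eigenvalues `conj ζ_i · exp(-λ_i)`, so `z` is
in the spectrum iff `exp(-z)` is one of them (`mem_range_eigenvalue_iff`). Their moduli determine
the `λ_i`, so the two sorted lists match in the sense `|μ_n| = exp(-λ_n)`
(`norm_eq_exp_of_sequences`), and taking logarithms finishes. -/

theorem app_eq {T : E →ₗ.[ℂ] E} {x : E} (h : x ∈ T.domain) : app T x = T ⟨x, h⟩ := by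
  simp [app, h]

/-- The map `(x, y) ↦ y - z x` on the graph of an operator. -/
def graphShift (T : E →ₗ.[ℂ] E) (z : ℂ) : T.graph →L[ℂ] E :=
  (ContinuousLinearMap.snd ℂ E E - z • ContinuousLinearMap.fst ℂ E E).comp T.graph.subtypeL

/-- A lower bound in terms of `x` also controls `T x`, since `‖T x‖ ≤ ‖T x - z x‖ + ‖z‖ ‖x‖`; the
constant `1 + (1 + ‖z‖)/c` dominates both coordinates of the graph norm. -/
theorem antilipschitz_graphShift {T : E →ₗ.[ℂ] E} {z : ℂ} {c : ℝ} (hc : 0 < c)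
    (h : ∀ x : T.domain, c * ‖(x : E)‖ ≤ ‖T x - z • (x : E)‖) :
    ∃ K, AntilipschitzWith K (graphShift T z) := by
  refine ⟨Real.toNNReal (1 + (1 + ‖z‖) / c), ?_⟩
  refine AddMonoidHomClass.antilipschitz_of_bound _ fun p => ?_
  obtain ⟨⟨x, y⟩, hp⟩ := p
  obtain ⟨a, ha, hb⟩ := (T.mem_graph_iff).1 hp
  simp only at ha hb
  have h1 := h a
  rw [ha, hb] at h1
  have hx : ‖x‖ ≤ ‖y - z • x‖ / c := by
    rw [le_div_iff₀ hc]; linarith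
  have hy : ‖y‖ ≤ ‖y - z • x‖ + ‖z‖ * ‖x‖ := by
    calc ‖y‖ = ‖(y - z • x) + z • x‖ := by simp
      _ ≤ _ := (norm_add_le _ _).trans (by rw [norm_smul])
  have hr : (0 : ℝ) ≤ ‖y - z • x‖ / c := by positivity
  rw [Real.coe_toNNReal _ (by positivity)]
  have e : (1 + (1 + ‖z‖) / c) * ‖y - z • x‖
      = ‖y - z • x‖ + (1 + ‖z‖) * (‖y - z • x‖ / c) := by ring
  change max ‖x‖ ‖y‖ ≤ _ * ‖y - z • x‖
  rw [e]
  have hz := norm_nonneg z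
  refine max_le ?_ ?_
  · nlinarith [norm_nonneg (y - z • x)]
  · nlinarith [mul_le_mul_of_nonneg_left hx hz]

theorem mem_pmapSpectrum_of_eigenvector {N : E →ₗ.[ℂ] E} {u : E} (hu : u ∈ N.domain) (hu0 : u ≠ 0)
    {ν : ℂ} (hν : N ⟨u, hu⟩ = ν • u) : ν ∈ pmapSpectrum N := by
  rintro ⟨R, -, hR⟩
  have := hR ⟨u, hu⟩
  rw [hν, sub_self, map_zero] at this
  exact hu0 this.symm

variable [CompleteSpace E]

/-- A closed operator `T` such that `T - z` is bounded below and has dense range has a resolvent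
at `z`. -/
theorem exists_resolvent_of_boundedBelow {T : E →ₗ.[ℂ] E} (hT : T.IsClosed) {z : ℂ} {c : ℝ}
    (hc : 0 < c) (h : ∀ x : T.domain, c * ‖(x : E)‖ ≤ ‖T x - z • (x : E)‖)
    (hd : ∀ w : E, (∀ x : T.domain, ⟪w, T x - z • (x : E)⟫_ℂ = 0) → w = 0) :
    ∃ R : E →L[ℂ] E, IsResolventAt T z R := by
  obtain ⟨K, hK⟩ := antilipschitz_graphShift hc h
  -- The graph of a closed operator is complete, so its antilipschitz image is closed; the
  -- orthogonality hypothesis `hd` then makes the range everything.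
  have : CompleteSpace T.graph := IsClosed.completeSpace_coe (hs := hT)
  have hcl : IsClosed ((graphShift T z).range : Set E) := by
    have := hK.isClosed_range (graphShift T z).uniformContinuous
    exact this
  have hsurj : (graphShift T z).range = ⊤ := by
    have : CompleteSpace (graphShift T z).range := hcl.completeSpace_coe
    rw [← Submodule.orthogonal_eq_bot_iff, Submodule.eq_bot_iff]
    intro w hw
    refine hd w fun x => ?_
    rw [Submodule.mem_orthogonal'] at hw
    exact hw _ ⟨⟨((x : E), T x), T.mem_graph x⟩, rfl⟩
  have hker : (graphShift T z).ker = ⊥ := LinearMap.ker_eq_bot.2 hK.injective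
  let e := ContinuousLinearEquiv.ofBijective (graphShift T z) hker hsurj
  refine ⟨(ContinuousLinearMap.fst ℂ E E).comp
    (T.graph.subtypeL.comp (e.symm : E →L[ℂ] T.graph)), ?_, ?_⟩
  · intro y
    have hy : graphShift T z (e.symm y) = y := e.apply_symm_apply y
    obtain ⟨a, ha, hb⟩ := (T.mem_graph_iff).1 (e.symm y).2
    have hm : ((e.symm y : T.graph) : E × E).1 ∈ T.domain := ha ▸ a.2
    refine ⟨hm, ?_⟩
    have : (⟨_, hm⟩ : T.domain) = a := Subtype.ext ha.symm
    change T ⟨((e.symm y : T.graph) : E × E).1, hm⟩ - z • ((e.symm y : T.graph) : E × E).1 = y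
    rw [this, hb]
    exact hy
  · intro x
    have : e ⟨((x : E), T x), T.mem_graph x⟩ = T x - z • (x : E) := rfl
    rw [← this]
    simp

/-- On expanding both squares, the cross terms have the same real part because `⟪N* y, x⟫` is the
conjugate of `⟪N x, x⟫`. -/
theorem IsFormallyNormal.norm_sub_smul_eq {N : E →ₗ.[ℂ] E} (hN : IsFormallyNormal N) (z : ℂ)
    (x : N.domain) (y : N†.domain) (hxy : (x : E) = y) :
    ‖N x - z • (x : E)‖ = ‖N† y - (starRingEnd ℂ) z • (y : E)‖ := by
  have h1 := hN.norm_eq x y hxy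
  have h2 := LinearPMap.adjoint_isFormalAdjoint hN.dense y x
  rw [← sq_eq_sq₀ (norm_nonneg _) (norm_nonneg _), @norm_sub_sq ℂ, @norm_sub_sq ℂ, h1, norm_smul,
    norm_smul, RCLike.norm_conj, ← hxy, inner_smul_right, inner_smul_right]
  have h3 : ⟪N† y, (x : E)⟫_ℂ = (starRingEnd ℂ) ⟪N x, (x : E)⟫_ℂ := by
    rw [h2, ← hxy, inner_conj_symm]
  rw [h3, ← map_mul, RCLike.conj_re]

/-- Only density of the range needs an argument. A vector orthogonal to the range of `N - z` is an
eigenvector of `N*` for `conj z`, if nonzero; normality makes it one of `N` for `z`, which the lower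
bound excludes. -/
theorem IsNormal.exists_resolvent {N : E →ₗ.[ℂ] E} (hN : IsNormal N) {z : ℂ} {c : ℝ}
    (hc : 0 < c) (h : ∀ x : N.domain, c * ‖(x : E)‖ ≤ ‖N x - z • (x : E)‖) :
    ∃ R : E →L[ℂ] E, IsResolventAt N z R := by
  refine exists_resolvent_of_boundedBelow hN.closed hc h fun w hw => ?_
  have hw' : ∀ x : N.domain, ⟪(starRingEnd ℂ) z • w, (x : E)⟫_ℂ = ⟪w, N x⟫_ℂ := by
    intro x
    have := hw x
    rw [inner_sub_right, inner_smul_right, sub_eq_zero] at this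
    rw [inner_smul_left, Complex.conj_conj, this]
  have hm : w ∈ N†.domain := LinearPMap.mem_adjoint_domain_of_exists w ⟨_, hw'⟩
  have hv : N† ⟨w, hm⟩ = (starRingEnd ℂ) z • w := LinearPMap.adjoint_apply_eq hN.dense _ hw'
  have hm' : w ∈ N.domain := hN.domain_eq ▸ hm
  have := hN.norm_sub_smul_eq z ⟨w, hm'⟩ ⟨w, hm⟩ rfl
  rw [hv, sub_self, norm_zero] at this
  have h2 := h ⟨w, hm'⟩
  rw [this] at h2
  exact norm_le_zero_iff.1 (nonpos_of_mul_nonpos_right h2 hc)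

theorem isNormal_of_isSelfAdjoint {T : E →ₗ.[ℂ] E} (hT : IsSelfAdjoint T) : IsNormal T := by
  have e : T† = T := LinearPMap.isSelfAdjoint_def.1 hT
  refine ⟨⟨hT.dense_domain, hT.isClosed, by rw [e], ?_⟩, by rw [e]⟩
  rw [e]
  intro x y hxy
  rw [Subtype.ext hxy]

theorem inner_apply_eq_of_isSelfAdjoint {T : E →ₗ.[ℂ] E} (hT : IsSelfAdjoint T) (x y : T.domain) :
    ⟪T x, (y : E)⟫_ℂ = ⟪(x : E), T y⟫_ℂ := by
  have e : T† = T := LinearPMap.isSelfAdjoint_def.1 hT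
  have := LinearPMap.adjoint_isFormalAdjoint hT.dense_domain
  rw [e] at this
  exact this x y

/-- The resolvent of a self-adjoint operator at the imaginary unit. -/
theorem exists_resolvent_I {T : E →ₗ.[ℂ] E} (hT : IsSelfAdjoint T) :
    ∃ R : E →L[ℂ] E, IsResolventAt T Complex.I R := by
  refine (isNormal_of_isSelfAdjoint hT).exists_resolvent one_pos fun x => ?_
  rw [one_mul]
  refine abs_le_of_sq_le_sq' ?_ (norm_nonneg _) |>.2
  rw [@norm_sub_sq ℂ, norm_smul, Complex.norm_I, one_mul, inner_smul_right]
  -- As `⟪T x, x⟫` is real, the cross term vanishes and `‖(T - i) x‖² = ‖T x‖² + ‖x‖²`.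
  have h1 : (⟪T x, (x : E)⟫_ℂ).im = 0 := by
    have := inner_apply_eq_of_isSelfAdjoint hT x x
    rw [← inner_conj_symm] at this
    have h2 := congrArg Complex.im this
    rw [Complex.conj_im] at h2
    rw [← inner_conj_symm, Complex.conj_im]
    linarith
  have h2 : RCLike.re (Complex.I * ⟪T x, (x : E)⟫_ℂ) = 0 := by
    simp [h1]
  rw [h2]
  nlinarith [sq_nonneg ‖T x‖]

/-- Expansion coefficients along an eigenvector of a normal operator. -/
theorem IsNormal.inner_eigenvector {N : E →ₗ.[ℂ] E} (hN : IsNormal N) {u : E} (hu : u ∈ N.domain)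
    {ν : ℂ} (hν : N ⟨u, hu⟩ = ν • u) (x : N.domain) : ⟪u, N x⟫_ℂ = ν * ⟪u, (x : E)⟫_ℂ := by
  have hu' : u ∈ N†.domain := hN.domain_eq ▸ hu
  -- Normality turns `u` into an eigenvector of `N*` for `conj ν`.
  have h := hN.norm_sub_smul_eq ν ⟨u, hu⟩ ⟨u, hu'⟩ rfl
  rw [hν, sub_self, norm_zero, eq_comm, norm_eq_zero, sub_eq_zero] at h
  have := LinearPMap.adjoint_isFormalAdjoint hN.dense ⟨u, hu'⟩ x
  rw [← this, h, inner_smul_left, Complex.conj_conj]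

/-- A point at positive distance from the eigenvalues of a normal operator with a Hilbert basis of
eigenvectors is not in the spectrum. -/
theorem IsNormal.not_mem_pmapSpectrum {N : E →ₗ.[ℂ] E} (hN : IsNormal N) {ι : Type*}
    (b : HilbertBasis ι ℂ E) (ν : ι → ℂ) (hb : ∀ i, ∃ h : b i ∈ N.domain, N ⟨b i, h⟩ = ν i • b i)
    {z : ℂ} {c : ℝ} (hc : 0 < c) (hz : ∀ i, c ≤ ‖ν i - z‖) : z ∉ pmapSpectrum N := by
  intro hspec
  refine hspec (hN.exists_resolvent hc fun x => ?_)
  have hsq : ∀ v : E, HasSum (fun i => ‖⟪b i, v⟫_ℂ‖ ^ 2) (‖v‖ ^ 2) := by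
    intro v
    have h := b.hasSum_inner_mul_inner v v
    rw [inner_self_eq_norm_sq_to_K] at h
    have h2 := Complex.hasSum_re h
    convert h2 using 1
    · funext i
      rw [← inner_conj_symm v (b i), Complex.conj_mul']
      norm_cast
    · norm_cast
  refine abs_le_of_sq_le_sq' ?_ (norm_nonneg _) |>.2
  rw [mul_pow]
  -- Parseval on both sides: the coefficients of `(N - z) x` are those of `x` times `ν i - z`.
  refine hasSum_le (fun i => ?_) ((hsq x).mul_left (c ^ 2)) (hsq _)
  obtain ⟨h, h'⟩ := hb i
  rw [inner_sub_right, inner_smul_right, hN.inner_eigenvector h h' x, ← sub_mul, norm_mul, mul_pow]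
  gcongr
  exact hz i

end NormalOperators

/-! ### Joint diagonalization of a compact and a unitary operator -/

section Diagonalization

variable {E : Type*} [NormedAddCommGroup E] [InnerProductSpace ℂ E]

/-- The joint eigenspaces of two operators. -/
def jointEigenspace (K W : E →L[ℂ] E) (p : ℂ × ℂ) : Submodule ℂ E :=
  Module.End.eigenspace (K : Module.End ℂ E) p.1 ⊓ Module.End.eigenspace (W : Module.End ℂ E) p.2

theorem mem_jointEigenspace {K W : E →L[ℂ] E} {p : ℂ × ℂ} {x : E} :
    x ∈ jointEigenspace K W p ↔ K x = p.1 • x ∧ W x = p.2 • x := by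
  simp [jointEigenspace]

/-- Otherwise infinitely many vectors `K (b i)` would be at mutual distance at least `ε`, already
seen in the component along one `b i`, and no subsequence could converge. -/
theorem finite_setOf_le_norm_eigenvalue {K : E →L[ℂ] E} (hc : IsCompactOperator K) {ι : Type*}
    {b : ι → E} (hb : Orthonormal ℂ b) {κ : ι → ℂ} (hκ : ∀ i, K (b i) = κ i • b i) {ε : ℝ}
    (hε : 0 < ε) : {i | ε ≤ ‖κ i‖}.Finite := by
  by_contra hinf
  have : Infinite {i | ε ≤ ‖κ i‖} := Set.infinite_coe_iff.2 hinf
  let f := Infinite.natEmbedding {i | ε ≤ ‖κ i‖}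
  have hcomp := hc.isCompact_closure_image_closedBall 1
  obtain ⟨x, -, φ, hφ, hlim⟩ := hcomp.tendsto_subseq (x := fun n => K (b (f n)))
    (fun n => subset_closure ⟨b (f n), by simp [hb.1], rfl⟩)
  have hcau := hlim.cauchySeq
  rw [Metric.cauchySeq_iff'] at hcau
  obtain ⟨N, hN⟩ := hcau ε hε
  have h1 := hN (N + 1) (Nat.le_succ N)
  have hne : (f (φ (N + 1)) : ι) ≠ f (φ N) := fun h => by
    have := hφ.injective (f.injective (Subtype.ext h))
    omega
  have h2 : ε ≤ ‖κ (f (φ (N + 1)))‖ := (f (φ (N + 1))).2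
  rw [dist_eq_norm] at h1
  simp only [Function.comp_apply, hκ] at h1
  have h3 : ⟪b (f (φ (N + 1))), κ (f (φ (N + 1))) • b (f (φ (N + 1))) - κ (f (φ N)) • b (f (φ N))⟫_ℂ
      = κ (f (φ (N + 1))) := by
    rw [inner_sub_right, inner_smul_right, inner_smul_right, hb.2 hne,
      inner_self_eq_norm_sq_to_K, hb.1]
    simp
  have h4 := norm_inner_le_norm (𝕜 := ℂ) (b (f (φ (N + 1))))
    (κ (f (φ (N + 1))) • b (f (φ (N + 1))) - κ (f (φ N)) • b (f (φ N)))
  rw [h3, hb.1, one_mul] at h4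
  linarith

variable [CompleteSpace E]

theorem star_apply_unitary_apply {W : E →L[ℂ] E} (hW : W ∈ unitary (E →L[ℂ] E)) (x : E) :
    star W (W x) = x :=
  DFunLike.congr_fun (Unitary.star_mul_self_of_mem hW) x

theorem inner_unitary_apply {W : E →L[ℂ] E} (hW : W ∈ unitary (E →L[ℂ] E)) (x y : E) :
    ⟪W x, W y⟫_ℂ = ⟪x, y⟫_ℂ := by
  rw [← ContinuousLinearMap.adjoint_inner_right, ← ContinuousLinearMap.star_eq_adjoint,
    star_apply_unitary_apply hW]

theorem norm_eigenvalue_unitary {W : E →L[ℂ] E} (hW : W ∈ unitary (E →L[ℂ] E)) {x : E}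
    (hx : x ≠ 0) {ζ : ℂ} (h : W x = ζ • x) : ‖ζ‖ = 1 := by
  have h1 := inner_unitary_apply hW x x
  rw [h, inner_smul_left, inner_smul_right, ← mul_assoc, Complex.conj_mul'] at h1
  have h2 : ((‖ζ‖ : ℂ)) ^ 2 = 1 := mul_right_cancel₀ (inner_self_ne_zero.2 hx) (h1.trans (one_mul _).symm)
  have h3 : ‖ζ‖ ^ 2 = 1 := by exact_mod_cast h2
  exact (pow_eq_one_iff_of_nonneg (norm_nonneg _) two_ne_zero).1 h3

theorem star_apply_eigenvector_unitary {W : E →L[ℂ] E} (hW : W ∈ unitary (E →L[ℂ] E)) {x : E}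
    {ζ : ℂ} (h : W x = ζ • x) : star W x = (starRingEnd ℂ) ζ • x := by
  rcases eq_or_ne x 0 with rfl | hx
  · simp
  have h1 := star_apply_unitary_apply hW x
  rw [h, map_smul] at h1
  have h2 : (starRingEnd ℂ) ζ * ζ = 1 := by
    rw [Complex.conj_mul', norm_eigenvalue_unitary hW hx h]; simp
  calc star W x = ((starRingEnd ℂ) ζ * ζ) • star W x := by rw [h2, one_smul]
    _ = _ := by rw [mul_smul, h1]

theorem inner_jointEigenspace {K W : E →L[ℂ] E} (hK : (K : E →ₗ[ℂ] E).IsSymmetric)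
    (hW : W ∈ unitary (E →L[ℂ] E)) {p q : ℂ × ℂ} (hpq : p ≠ q) {x y : E}
    (hx : x ∈ jointEigenspace K W p) (hy : y ∈ jointEigenspace K W q) : ⟪x, y⟫_ℂ = 0 := by
  rw [mem_jointEigenspace] at hx hy
  by_cases h1 : p.1 = q.1
  · have h2 : p.2 ≠ q.2 := fun h => hpq (Prod.ext h1 h)
    rcases eq_or_ne x 0 with rfl | hx0
    · simp
    have h3 : ⟪W x, y⟫_ℂ = ⟪x, star W y⟫_ℂ := by
      rw [ContinuousLinearMap.star_eq_adjoint, ContinuousLinearMap.adjoint_inner_right]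
    rw [hx.2, star_apply_eigenvector_unitary hW hy.2, inner_smul_left, inner_smul_right] at h3
    have h4 : ((starRingEnd ℂ) p.2 - (starRingEnd ℂ) q.2) * ⟪x, y⟫_ℂ = 0 := by
      rw [sub_mul, h3, sub_self]
    refine (mul_eq_zero.1 h4).resolve_left fun h5 => h2 ?_
    exact (starRingEnd ℂ).injective (sub_eq_zero.1 h5)
  · exact hK.orthogonalFamily_eigenspaces h1 ⟨x, Module.End.mem_eigenspace_iff.2 hx.1⟩
      ⟨y, Module.End.mem_eigenspace_iff.2 hy.1⟩

/-- Inside the eigenspace, the complement `Sᗮ ⊓ F` of the span `S` of joint eigenvectors is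
invariant under `W`. Were it nonzero, `W` would have an eigenvector in this finite-dimensional
space, and that vector would lie in `S` as well. -/
theorem eigenspace_eq_iSup_jointEigenspace {K W : E →L[ℂ] E}
    (hW : W ∈ unitary (E →L[ℂ] E)) (hKW : ∀ x, K (W x) = W (K x)) (μ : ℂ)
    [FiniteDimensional ℂ (Module.End.eigenspace (K : Module.End ℂ E) μ)] :
    Module.End.eigenspace (K : Module.End ℂ E) μ ≤ ⨆ ζ, jointEigenspace K W (μ, ζ) := by
  set F := Module.End.eigenspace (K : Module.End ℂ E) μ
  set S : Submodule ℂ E := ⨆ ζ, jointEigenspace K W (μ, ζ)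
  have hS : S ≤ F := iSup_le fun ζ => inf_le_left
  have : FiniteDimensional ℂ S := Submodule.finiteDimensional_of_le hS
  have hM : Sᗮ ⊓ F = ⊥ := by
    by_contra hne
    have hFD : FiniteDimensional ℂ ↥(Sᗮ ⊓ F) := Submodule.finiteDimensional_of_le inf_le_right
    have hmaps : ∀ x ∈ Sᗮ ⊓ F, (W : E →ₗ[ℂ] E) x ∈ Sᗮ ⊓ F := by
      rintro x ⟨hx1, hx2⟩
      refine ⟨?_, ?_⟩
      · rw [SetLike.mem_coe, Submodule.mem_orthogonal] at hx1 ⊢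
        intro y hy
        induction hy using Submodule.iSup_induction' with
        | mem ζ y hy =>
          have h3 : ⟪y, W x⟫_ℂ = ⟪star W y, x⟫_ℂ := by
            rw [ContinuousLinearMap.star_eq_adjoint, ContinuousLinearMap.adjoint_inner_left]
          change ⟪y, W x⟫_ℂ = 0
          rw [h3, star_apply_eigenvector_unitary hW (mem_jointEigenspace.1 hy).2, inner_smul_left,
            hx1 y (Submodule.mem_iSup_of_mem ζ hy), mul_zero]
        | zero => simp
        | add y z _ _ h1 h2 => rw [inner_add_left, h1, h2, add_zero]
      · have hx3 : K x = μ • x := Module.End.mem_eigenspace_iff.1 hx2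
        refine Module.End.mem_eigenspace_iff.2 ?_
        change K (W x) = μ • W x
        rw [hKW, hx3, map_smul]
    have : Nontrivial ↥(Sᗮ ⊓ F) := Submodule.nontrivial_iff_ne_bot.2 hne
    obtain ⟨ζ, hζ⟩ := Module.End.exists_eigenvalue ((W : E →ₗ[ℂ] E).restrict hmaps)
    obtain ⟨⟨x, hx⟩, hxe⟩ := hζ.exists_hasEigenvector
    have hx1 : W x = ζ • x := congrArg Subtype.val hxe.apply_eq_smul
    have hx2 : K x = μ • x := Module.End.mem_eigenspace_iff.1 hx.2
    have hxS : x ∈ S := Submodule.mem_iSup_of_mem ζ (mem_jointEigenspace.2 ⟨hx2, hx1⟩)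
    have : x = 0 := by
      have := (Submodule.mem_orthogonal S x).1 hx.1 x hxS
      exact inner_self_eq_zero.1 this
    exact hxe.2 (Subtype.ext this)
  have := Submodule.sup_orthogonal_inf_of_hasOrthogonalProjection hS
  rw [hM, sup_bot_eq] at this
  exact this.ge

/-- An injective compact symmetric operator and a unitary operator which commute have a Hilbert
basis of joint eigenvectors. -/
theorem exists_joint_eigenbasis {K W : E →L[ℂ] E} (hc : IsCompactOperator K)
    (hK : (K : E →ₗ[ℂ] E).IsSymmetric) (hinj : ∀ x, K x = 0 → x = 0)
    (hW : W ∈ unitary (E →L[ℂ] E)) (hKW : ∀ x, K (W x) = W (K x)) :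
    ∃ (ι : Type) (b : HilbertBasis ι ℂ E) (κ ζ : ι → ℂ),
      ∀ i, K (b i) = κ i • b i ∧ W (b i) = ζ i • b i := by
  -- Compactness says nothing about the eigenvalue `0`; injectivity removes it, so all eigenspaces
  -- are finite-dimensional.
  have hbot : Module.End.eigenspace (K : Module.End ℂ E) 0 = ⊥ := by
    rw [Submodule.eq_bot_iff]
    intro x hx
    rw [Module.End.mem_eigenspace_iff, zero_smul] at hx
    exact hinj x hx
  have hfd : ∀ μ, FiniteDimensional ℂ (Module.End.eigenspace (K : Module.End ℂ E) μ) := by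
    intro μ
    rcases eq_or_ne μ 0 with rfl | hμ
    · rw [hbot]; infer_instance
    · exact ContinuousLinearMap.finite_dimensional_eigenspace hc μ hμ
  have hfd' : ∀ p, FiniteDimensional ℂ (jointEigenspace K W p) := fun p =>
    have := hfd p.1
    Submodule.finiteDimensional_of_le (inf_le_left :
      _ ≤ Module.End.eigenspace (K : Module.End ℂ E) p.1)
  have horth : OrthogonalFamily ℂ (fun p => jointEigenspace K W p)
      fun p => (jointEigenspace K W p).subtypeₗᵢ :=
    fun p q hpq x y => inner_jointEigenspace hK hW hpq x.2 y.2
  let B : ∀ p, OrthonormalBasis (Fin (Module.finrank ℂ (jointEigenspace K W p))) ℂ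
    (jointEigenspace K W p) := fun p => stdOrthonormalBasis ℂ _
  have hon := horth.orthonormal_sigma_orthonormal fun p => (B p).orthonormal
  have hcompl : (Submodule.span ℂ (range fun a : Σ p, Fin (Module.finrank ℂ
      (jointEigenspace K W p)) => (jointEigenspace K W a.1).subtypeₗᵢ (B a.1 a.2)))ᗮ = ⊥ := by
    rw [eq_bot_iff, ← ContinuousLinearMap.orthogonalComplement_iSup_eigenspaces_eq_bot hc hK]
    refine Submodule.orthogonal_le (iSup_le fun μ => ?_)
    have := hfd μ
    refine (eigenspace_eq_iSup_jointEigenspace hW hKW μ).trans (iSup_le fun ζ => ?_)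
    intro x hx
    have h1 := (B (μ, ζ)).sum_repr ⟨x, hx⟩
    have h2 : ((∑ i, (B (μ, ζ)).repr ⟨x, hx⟩ i • B (μ, ζ) i : jointEigenspace K W (μ, ζ)) : E) = x :=
      congrArg Subtype.val h1
    rw [← h2, Submodule.coe_sum]
    exact Submodule.sum_mem _ fun i _ => Submodule.smul_mem _ _
      (Submodule.subset_span ⟨⟨(μ, ζ), i⟩, rfl⟩)
  refine ⟨_, HilbertBasis.mkOfOrthogonalEqBot hon hcompl, fun a => a.1.1, fun a => a.1.2, ?_⟩
  intro a
  rw [HilbertBasis.coe_mkOfOrthogonalEqBot]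
  exact mem_jointEigenspace.1 (B a.1 a.2).2

/-- The continuous functional calculus of a self-adjoint operator on an eigenvector. -/
theorem cfc_apply_eigenvector {K : E →L[ℂ] E} (hK : IsSelfAdjoint K) {f : ℝ → ℝ}
    (hf : Differentiable ℝ f) {κ : ℝ} {x : E} (hx : K x = (κ : ℂ) • x) :
    cfc f K x = (f κ : ℂ) • x := by
  -- Writing `f y = f κ + g y (y - κ)` with `g` the continuous slope gives `f(K) - f(κ) = g(K) (K -
  -- κ)`, which annihilates `x`.
  have hg : Continuous (dslope f κ) := by
    rw [continuous_iff_continuousAt]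
    intro y
    rcases eq_or_ne y κ with rfl | hy
    · exact continuousAt_dslope_same.2 (hf y)
    · exact (continuousAt_dslope_of_ne hy).2 (hf y).continuousAt
  have h1 : f = fun y => f κ + dslope f κ y * (y - κ) := by
    funext y
    have := sub_smul_dslope f κ y
    rw [smul_eq_mul] at this
    linarith
  have h2 : cfc f K = algebraMap ℝ (E →L[ℂ] E) (f κ) +
      cfc (dslope f κ) K * (K - algebraMap ℝ (E →L[ℂ] E) κ) := by
    conv_lhs => rw [h1]
    rw [cfc_add .., cfc_const .., cfc_mul .., cfc_sub .., cfc_id' .., cfc_const ..]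
  rw [h2]
  simp [Algebra.algebraMap_eq_smul_one, hx]

end Diagonalization

/-! ### The bounded inverse of a self-adjoint operator -/

section Inverse

variable {E : Type*} [NormedAddCommGroup E] [InnerProductSpace ℂ E]

theorem IsResolventAt.apply_mem {T : E →ₗ.[ℂ] E} {z : ℂ} {R : E →L[ℂ] E}
    (h : IsResolventAt T z R) (x : E) : R x ∈ T.domain := (h.1 x).1

theorem IsResolventAt.app_apply {T : E →ₗ.[ℂ] E} {R : E →L[ℂ] E}
    (h : IsResolventAt T 0 R) (x : E) : app T (R x) = x := by
  obtain ⟨h1, h2⟩ := h.1 x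
  rw [app_eq h1]
  simpa using h2

theorem IsResolventAt.apply_app {T : E →ₗ.[ℂ] E} {R : E →L[ℂ] E}
    (h : IsResolventAt T 0 R) {x : E} (hx : x ∈ T.domain) : R (app T x) = x := by
  rw [app_eq hx]
  simpa using h.2 ⟨x, hx⟩

theorem IsResolventAt.injective {T : E →ₗ.[ℂ] E} {R : E →L[ℂ] E}
    (h : IsResolventAt T 0 R) {x : E} (hx : R x = 0) : x = 0 := by
  rw [← h.app_apply x, hx, app_eq T.domain.zero_mem]
  exact T.map_zero

theorem inner_app_eq_of_isSelfAdjoint [CompleteSpace E] {T : E →ₗ.[ℂ] E} (hT : IsSelfAdjoint T)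
    {x y : E} (hx : x ∈ T.domain) (hy : y ∈ T.domain) : ⟪app T x, y⟫_ℂ = ⟪x, app T y⟫_ℂ := by
  rw [app_eq hx, app_eq hy]
  exact inner_apply_eq_of_isSelfAdjoint hT ⟨x, hx⟩ ⟨y, hy⟩

theorem IsResolventAt.isSymmetric [CompleteSpace E] {T : E →ₗ.[ℂ] E} (hT : IsSelfAdjoint T)
    {R : E →L[ℂ] E} (h : IsResolventAt T 0 R) : (R : E →ₗ[ℂ] E).IsSymmetric := by
  intro x y
  have := inner_app_eq_of_isSelfAdjoint hT (h.apply_mem x) (h.apply_mem y)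
  rw [h.app_apply, h.app_apply] at this
  exact this.symm

theorem app_smul {T : E →ₗ.[ℂ] E} (c : ℂ) {x : E} (hx : x ∈ T.domain) :
    app T (c • x) = c • app T x := by
  rw [app_eq (T.domain.smul_mem c hx), app_eq hx]
  exact T.map_smul c ⟨x, hx⟩

theorem app_sub {T : E →ₗ.[ℂ] E} {x y : E} (hx : x ∈ T.domain) (hy : y ∈ T.domain) :
    app T (x - y) = app T x - app T y := by
  rw [app_eq (T.domain.sub_mem hx hy), app_eq hx, app_eq hy]
  exact T.map_sub ⟨x, hx⟩ ⟨y, hy⟩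

/-- A finite-dimensional eigenspace of a bounded operator commuting with a self-adjoint operator
`T` lies in the domain of `T`. -/
theorem eigenspace_le_domain [CompleteSpace E] {T : E →ₗ.[ℂ] E} (hT : IsSelfAdjoint T)
    {K : E →L[ℂ] E} (hKT : CommutesWith K T) (κ : ℂ)
    [FiniteDimensional ℂ (Module.End.eigenspace (K : Module.End ℂ E) κ)] :
    Module.End.eigenspace (K : Module.End ℂ E) κ ≤ T.domain := by
  obtain ⟨R, hR⟩ := exists_resolvent_I hT
  set F := Module.End.eigenspace (K : Module.End ℂ E) κ
  have hcomm : ∀ y, R (K y) = K (R y) := by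
    intro y
    obtain ⟨h1, h2⟩ := hR.1 y
    obtain ⟨h3, h4⟩ := hKT ⟨R y, h1⟩
    have h5 := hR.2 ⟨K (R y), h3⟩
    rw [h4] at h5
    simp only at h5
    rw [← map_smul, ← map_sub, h2] at h5
    exact h5
  have hmaps : ∀ x ∈ F, (R : E →ₗ[ℂ] E) x ∈ F := by
    intro x hx
    have hx' : K x = κ • x := Module.End.mem_eigenspace_iff.1 hx
    refine Module.End.mem_eigenspace_iff.2 ?_
    change K (R x) = κ • R x
    rw [← hcomm, hx', map_smul]
  -- The resolvent maps the finite-dimensional `F` injectively into itself, hence onto; so every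
  -- vector of `F` is in its range, which is contained in the domain of `T`.
  have hinj : Function.Injective ((R : E →ₗ[ℂ] E).restrict hmaps) := by
    rw [injective_iff_map_eq_zero]
    rintro ⟨x, hx⟩ h
    have h1 : R x = 0 := congrArg Subtype.val h
    obtain ⟨h2, h3⟩ := hR.1 x
    have h4 : (⟨R x, h2⟩ : T.domain) = 0 := Subtype.ext h1
    rw [h4, T.map_zero, h1] at h3
    simp only [smul_zero, sub_zero] at h3
    exact Subtype.ext h3.symm
  intro x hx
  obtain ⟨y, hy⟩ := LinearMap.surjective_of_injective hinj ⟨x, hx⟩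
  have h1 : R y = x := congrArg Subtype.val hy
  rw [← h1]
  exact hR.apply_mem _

end Inverse

/-! ### The coefficients `A(t)` and the evolution operators -/

section Coefficients

theorem exists_of_ae_Ioo {p : ℝ → Prop}
    (h : ∀ᵐ t ∂volume.restrict (Ioo (0 : ℝ) 1), p t) : ∃ t ∈ Ioo (0 : ℝ) 1, p t := by
  have : (ae (volume.restrict (Ioo (0 : ℝ) 1))).NeBot := by
    rw [ae_neBot, Ne, Measure.restrict_eq_zero]; simp
  exact (h.and (ae_restrict_mem measurableSet_Ioo)).exists.imp fun t ht => ⟨ht.2, ht.1⟩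

variable {H : Type*} [NormedAddCommGroup H] [InnerProductSpace ℂ H]
  {α : ℝ → ℝ} {D : Submodule ℂ H} {A Ar Ai : ℝ → H →ₗ.[ℂ] H} {C : H →ₗ.[ℂ] H}

theorem domain_real_eq {t : ℝ} {c : ℂ}
    (h : Ar t = (c • (LinearMap.id : H →ₗ[ℂ] H)) +ᵥ C) : (Ar t).domain = C.domain := by
  rw [h]; rfl

theorem app_real {t : ℝ} {c : ℂ} (h : Ar t = (c • (LinearMap.id : H →ₗ[ℂ] H)) +ᵥ C)
    {f : H} (hf : f ∈ C.domain) : app (Ar t) f = c • f + app C f := by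
  have h1 : f ∈ ((c • (LinearMap.id : H →ₗ[ℂ] H)) +ᵥ C).domain := hf
  rw [h, app_eq h1, app_eq hf]
  rfl

/-- Since `A_r(t) - c = C`, inverting `C` is the same as taking the resolvent of `A_r(t)` at `c`.
This is how strong commutation of `A_r(t)` and `A_i(t)` becomes commutation of `C⁻¹` with `A_i(t)`.
-/
theorem isResolventAt_real {t : ℝ} {c : ℂ} (h : Ar t = (c • (LinearMap.id : H →ₗ[ℂ] H)) +ᵥ C)
    {K : H →L[ℂ] H} (hK : IsResolventAt C 0 K) : IsResolventAt (Ar t) c K := by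
  have e : ∀ x ∈ C.domain, app (Ar t) x - c • x = app C x := fun x hx => by
    rw [app_real h hx, add_sub_cancel_left]
  refine ⟨fun y => ?_, fun x => ?_⟩
  · have h1 : K y ∈ (Ar t).domain := by rw [domain_real_eq h]; exact hK.apply_mem y
    refine ⟨h1, ?_⟩
    rw [← app_eq h1, e _ (hK.apply_mem y), hK.app_apply]
  · have h1 : (x : H) ∈ C.domain := domain_real_eq h ▸ x.2
    have h2 : Ar t x = app (Ar t) x := (app_eq x.2).symm
    rw [h2, e _ h1, hK.apply_app h1]

variable [CompleteSpace H]

namespace StandingAssumptions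

theorem mem_iff (hA : StandingAssumptions α D A Ar Ai C) {t : ℝ} (ht : t ∈ Icc (0 : ℝ) 1) {f : H} :
    f ∈ D ↔ f ∈ (Ar t).domain ∧ f ∈ (Ai t).domain := by
  rw [← hA.domain_eq t ht, hA.decomposition t ht, LinearPMap.add_domain, Submodule.mem_inf]
  rfl

theorem app_coefficient (hA : StandingAssumptions α D A Ar Ai C) {t : ℝ} (ht : t ∈ Icc (0 : ℝ) 1)
    {f : H} (hf : f ∈ D) : app (A t) f = app (Ar t) f + Complex.I • app (Ai t) f := by
  obtain ⟨h1, h2⟩ := (hA.mem_iff ht).1 hf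
  have h3 : f ∈ (Ar t + Complex.I • Ai t).domain := ⟨h1, h2⟩
  rw [hA.decomposition t ht, app_eq h3, app_eq h1, app_eq h2]
  rfl

theorem app_adjoint_coefficient (hA : StandingAssumptions α D A Ar Ai C) {t : ℝ}
    (ht : t ∈ Icc (0 : ℝ) 1) {f : H} (hf : f ∈ D) :
    app (A t)† f = app (Ar t) f - Complex.I • app (Ai t) f := by
  have hdense : Dense ((A t).domain : Set H) := by rw [hA.domain_eq t ht]; exact hA.dense
  have key : ∀ x : (A t).domain,
      ⟪app (Ar t) f - Complex.I • app (Ai t) f, (x : H)⟫_ℂ = ⟪f, A t x⟫_ℂ := by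
    intro x
    have hx : (x : H) ∈ D := hA.domain_eq t ht ▸ x.2
    obtain ⟨h1, h2⟩ := (hA.mem_iff ht).1 hf
    obtain ⟨h3, h4⟩ := (hA.mem_iff ht).1 hx
    have h5 : A t x = app (A t) x := (app_eq x.2).symm
    rw [h5, hA.app_coefficient ht hx, inner_sub_left, inner_smul_left, inner_add_right,
      inner_smul_right, inner_app_eq_of_isSelfAdjoint (hA.real_selfAdjoint t ht) h1 h3,
      inner_app_eq_of_isSelfAdjoint (hA.imag_selfAdjoint t ht) h2 h4, Complex.conj_I]
    ring
  have hm : f ∈ (A t)†.domain := LinearPMap.mem_adjoint_domain_of_exists f ⟨_, key⟩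
  rw [app_eq hm]
  exact LinearPMap.adjoint_apply_eq hdense _ key

theorem ae_commutesWith_imag (hA : StandingAssumptions α D A Ar Ai C) {K : H →L[ℂ] H}
    (hK : IsResolventAt C 0 K) :
    ∀ᵐ t ∂volume.restrict (Ioo (0 : ℝ) 1), CommutesWith K (Ai t) := by
  filter_upwards [hA.normality, ae_restrict_mem measurableSet_Ioo] with t h ht
  exact hA.commute t (Ioo_subset_Icc_self ht) _ K (isResolventAt_real h hK)

theorem le_domain_const (hA : StandingAssumptions α D A Ar Ai C) : D ≤ C.domain := by
  obtain ⟨t, ht, h⟩ := exists_of_ae_Ioo hA.normality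
  intro f hf
  rw [← domain_real_eq h]
  exact ((hA.mem_iff (Ioo_subset_Icc_self ht)).1 hf).1

/-- As `D` does not depend on `t`, it is enough to find a single `t` at which normality and
commutation both hold. -/
theorem eigenspace_le (hA : StandingAssumptions α D A Ar Ai C) {K : H →L[ℂ] H}
    (hK : IsResolventAt C 0 K) {κ : ℂ} (hκ : κ ≠ 0)
    [FiniteDimensional ℂ (Module.End.eigenspace (K : Module.End ℂ H) κ)] :
    Module.End.eigenspace (K : Module.End ℂ H) κ ≤ D := by
  obtain ⟨t, ht, h, hcomm⟩ := exists_of_ae_Ioo (hA.normality.and (hA.ae_commutesWith_imag hK))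
  have ht' := Ioo_subset_Icc_self ht
  intro x hx
  have hx' : K x = κ • x := Module.End.mem_eigenspace_iff.1 hx
  refine (hA.mem_iff ht').2 ⟨?_, eigenspace_le_domain (hA.imag_selfAdjoint t ht') hcomm κ hx⟩
  rw [domain_real_eq h]
  have : x = κ⁻¹ • K x := by rw [hx', inv_smul_smul₀ hκ]
  rw [this]
  exact C.domain.smul_mem _ (hK.apply_mem x)

/-- Commutation is available only for almost every `t`; continuity of `t ↦ A_i(t) x` on the closed
interval extends the eigenvalue equation to all `t`, including the endpoints. -/
theorem app_imag_mem_eigenspace (hA : StandingAssumptions α D A Ar Ai C) {K : H →L[ℂ] H}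
    (hK : IsResolventAt C 0 K) {κ : ℂ} (hκ : κ ≠ 0)
    [FiniteDimensional ℂ (Module.End.eigenspace (K : Module.End ℂ H) κ)] {t : ℝ}
    (ht : t ∈ Icc (0 : ℝ) 1) {x : H} (hx : x ∈ Module.End.eigenspace (K : Module.End ℂ H) κ) :
    app (Ai t) x ∈ Module.End.eigenspace (K : Module.End ℂ H) κ := by
  have hxD := hA.eigenspace_le hK hκ hx
  have hx' : K x = κ • x := Module.End.mem_eigenspace_iff.1 hx
  have hcont := (hA.imag_smooth x hxD).continuousOn
  have key : EqOn (fun t => K (app (Ai t) x)) (fun t => κ • app (Ai t) x) (Icc 0 1) := by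
    refine Measure.eqOn_Icc_of_ae_eq volume zero_ne_one ?_
      (K.continuous.comp_continuousOn hcont) (hcont.const_smul κ)
    rw [← restrict_Ioo_eq_restrict_Icc]
    filter_upwards [hA.ae_commutesWith_imag hK, ae_restrict_mem measurableSet_Ioo] with t h ht
    have h1 := ((hA.mem_iff (Ioo_subset_Icc_self ht)).1 hxD).2
    obtain ⟨h2, h3⟩ := h ⟨x, h1⟩
    rw [← app_eq h2, ← app_eq h1] at h3
    simp only at h3
    rw [← h3, hx', app_smul κ h1]
  exact Module.End.mem_eigenspace_iff.2 (key ht)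

/-- The scalar product of two solutions of `x' + i A_i(t) x = 0` is constant. -/
theorem inner_solution_eq (hA : StandingAssumptions α D A Ar Ai C) {x y : ℝ → H}
    (hxm : ∀ t ∈ Icc (0 : ℝ) 1, x t ∈ (Ai t).domain)
    (hym : ∀ t ∈ Icc (0 : ℝ) 1, y t ∈ (Ai t).domain)
    (hx : ∀ t ∈ Icc (0 : ℝ) 1,
      HasDerivWithinAt x (-(Complex.I • app (Ai t) (x t))) (Icc 0 1) t)
    (hy : ∀ t ∈ Icc (0 : ℝ) 1,
      HasDerivWithinAt y (-(Complex.I • app (Ai t) (y t))) (Icc 0 1) t)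
    {t : ℝ} (ht : t ∈ Icc (0 : ℝ) 1) : ⟪x t, y t⟫_ℂ = ⟪x 0, y 0⟫_ℂ := by
  have hd : ∀ s ∈ Icc (0 : ℝ) 1, HasDerivWithinAt (fun s => ⟪x s, y s⟫_ℂ) 0 (Icc 0 1) s := by
    intro s hs
    refine ((hx s hs).inner ℂ (hy s hs)).congr_deriv ?_
    rw [inner_neg_right, inner_neg_left, inner_smul_left, inner_smul_right, Complex.conj_I,
      inner_app_eq_of_isSelfAdjoint (hA.imag_selfAdjoint s hs) (hxm s hs) (hym s hs)]
    ring
  refine constant_of_derivWithin_zero (f := fun s => ⟪x s, y s⟫_ℂ)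
    (fun s hs => (hd s hs).differentiableWithinAt) (fun s hs => ?_) t ht
  exact (hd s (Ico_subset_Icc_self hs)).derivWithin
    (uniqueDiffOn_Icc zero_lt_one s (Ico_subset_Icc_self hs))

theorem inner_evolution_eq (hA : StandingAssumptions α D A Ar Ai C) {U : ℝ → ℝ → H →L[ℂ] H}
    (hU : IsEvolutionFamily D Ai U) {f g : H} (hf : f ∈ D) (hg : g ∈ D) {t : ℝ}
    (ht : t ∈ Icc (0 : ℝ) 1) : ⟪U t 0 f, U t 0 g⟫_ℂ = ⟪f, g⟫_ℂ := by
  have h0 : (0 : ℝ) ∈ Icc (0 : ℝ) 1 := ⟨le_rfl, zero_le_one⟩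
  have := hA.inner_solution_eq (x := fun t => U t 0 f) (y := fun t => U t 0 g)
    (fun t ht => hU.mem_domain t ht 0 h0 f hf) (fun t ht => hU.mem_domain t ht 0 h0 g hg)
    (fun t ht => hU.equation t ht 0 h0 f hf) (fun t ht => hU.equation t ht 0 h0 g hg) ht
  simpa only [hU.initial 0 h0 f hf, hU.initial 0 h0 g hg] using this

/-- The eigenspace is invariant under the self-adjoint `A_i(t)`, so `A_i(t)` sends a domain vector
orthogonal to it to another orthogonal vector: the eigenspace reduces `A_i(t)`. -/
theorem starProjection_app_imag (hA : StandingAssumptions α D A Ar Ai C) {K : H →L[ℂ] H}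
    (hK : IsResolventAt C 0 K) {κ : ℂ} (hκ : κ ≠ 0)
    [FiniteDimensional ℂ (Module.End.eigenspace (K : Module.End ℂ H) κ)] {t : ℝ}
    (ht : t ∈ Icc (0 : ℝ) 1) {x : H} (hx : x ∈ (Ai t).domain) :
    (Module.End.eigenspace (K : Module.End ℂ H) κ).starProjection (app (Ai t) x) =
      app (Ai t) ((Module.End.eigenspace (K : Module.End ℂ H) κ).starProjection x) := by
  set F := Module.End.eigenspace (K : Module.End ℂ H) κ
  have hF : ∀ y ∈ F, y ∈ (Ai t).domain := fun y hy =>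
    ((hA.mem_iff ht).1 (hA.eigenspace_le hK hκ hy)).2
  have hPx : F.starProjection x ∈ F := F.starProjection_apply_mem x
  refine Submodule.eq_starProjection_of_mem_of_inner_eq_zero
    (hA.app_imag_mem_eigenspace hK hκ ht hPx) fun w hw => ?_
  have hw' := hA.app_imag_mem_eigenspace hK hκ ht hw
  have hs := hA.imag_selfAdjoint t ht
  rw [inner_sub_left, inner_app_eq_of_isSelfAdjoint hs hx (hF w hw),
    inner_app_eq_of_isSelfAdjoint hs (hF _ hPx) (hF w hw), ← inner_sub_left]
  exact F.starProjection_inner_eq_zero x _ hw'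

/-- The evolution operators preserve the eigenspaces of the constant operator. -/
theorem evolution_mem_eigenspace (hA : StandingAssumptions α D A Ar Ai C) {K : H →L[ℂ] H}
    (hK : IsResolventAt C 0 K) {U : ℝ → ℝ → H →L[ℂ] H}
    (hU : IsEvolutionFamily D Ai U) {κ : ℂ} (hκ : κ ≠ 0)
    [FiniteDimensional ℂ (Module.End.eigenspace (K : Module.End ℂ H) κ)] {t : ℝ}
    (ht : t ∈ Icc (0 : ℝ) 1) {f : H} (hf : f ∈ Module.End.eigenspace (K : Module.End ℂ H) κ) :
    U t 0 f ∈ Module.End.eigenspace (K : Module.End ℂ H) κ := by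
  have h0 : (0 : ℝ) ∈ Icc (0 : ℝ) 1 := ⟨le_rfl, zero_le_one⟩
  have hfD := hA.eigenspace_le hK hκ hf
  set F := Module.End.eigenspace (K : Module.End ℂ H) κ
  -- The component orthogonal to `F` solves the same equation and starts from `0`; its norm is
  -- conserved, so it stays `0`.
  let x : ℝ → H := fun s => U s 0 f - F.starProjection (U s 0 f)
  have hUm := fun s hs => hU.mem_domain s hs 0 h0 f hfD
  have hPm : ∀ s ∈ Icc (0 : ℝ) 1, F.starProjection (U s 0 f) ∈ (Ai s).domain := fun s hs =>
    ((hA.mem_iff hs).1 (hA.eigenspace_le hK hκ (F.starProjection_apply_mem _))).2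
  have hxm : ∀ s ∈ Icc (0 : ℝ) 1, x s ∈ (Ai s).domain := fun s hs =>
    (Ai s).domain.sub_mem (hUm s hs) (hPm s hs)
  have hx : ∀ s ∈ Icc (0 : ℝ) 1,
      HasDerivWithinAt x (-(Complex.I • app (Ai s) (x s))) (Icc 0 1) s := by
    intro s hs
    have h1 := hU.equation s hs 0 h0 f hfD
    have h2 := ((F.starProjection.restrictScalars ℝ).hasFDerivAt).comp_hasDerivWithinAt s h1
    refine (h1.sub h2).congr_deriv ?_
    change -(Complex.I • app (Ai s) (U s 0 f)) -
        F.starProjection (-(Complex.I • app (Ai s) (U s 0 f))) =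
      -(Complex.I • app (Ai s) (U s 0 f - F.starProjection (U s 0 f)))
    rw [app_sub (hUm s hs) (hPm s hs), map_neg, map_smul,
      hA.starProjection_app_imag hK hκ hs (hUm s hs), smul_sub]
    abel
  have h3 := hA.inner_solution_eq hxm hxm hx hx ht
  have h4 : x 0 = 0 := by
    change U 0 0 f - F.starProjection (U 0 0 f) = 0
    rw [hU.initial 0 h0 f hfD, Submodule.starProjection_eq_self_iff.2 hf, sub_self]
  rw [h4, inner_zero_left, inner_self_eq_zero] at h3
  have h5 : U t 0 f = F.starProjection (U t 0 f) := sub_eq_zero.1 h3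
  rw [h5]
  exact F.starProjection_apply_mem _

end StandingAssumptions

end Coefficients

/-! ### Positivity of the weight inside the interval -/

section Weight

variable {H : Type*} [NormedAddCommGroup H] [InnerProductSpace ℂ H]
  {α : ℝ → ℝ} {D : Submodule ℂ H} {A Ar Ai : ℝ → H →ₗ.[ℂ] H} {C : H →ₗ.[ℂ] H}

/-- A weight which is continuous on `[0, 1]`, and positive and continuously differentiable on
`(0, 1)`. -/
structure IsRegularWeight (α : ℝ → ℝ) : Prop where
  continuousOn : ContinuousOn α (Icc 0 1)
  pos : ∀ t ∈ Ioo (0 : ℝ) 1, 0 < α t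
  hasDerivAt : ∀ t ∈ Ioo (0 : ℝ) 1, HasDerivAt α (deriv α t) t
  continuousOn_deriv : ContinuousOn (deriv α) (Ioo 0 1)

/-- A solution of a homogeneous linear equation which vanishes at a point of `(0, 1)` vanishes
near that point. -/
theorem exists_eqOn_zero_of_deriv_eq {g c : ℝ → ℝ} (hc : ContinuousOn c (Ioo 0 1))
    (hg : ∀ t ∈ Ioo (0 : ℝ) 1, HasDerivAt g (c t * g t) t) {t₀ : ℝ} (ht₀ : t₀ ∈ Ioo (0 : ℝ) 1)
    (h0 : g t₀ = 0) : ∃ a b, a < b ∧ Ioo a b ⊆ Ioo 0 1 ∧ ∀ t ∈ Ioo a b, g t = 0 := by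
  have hnhds : Ioo (0 : ℝ) 1 ∈ 𝓝 t₀ := isOpen_Ioo.mem_nhds ht₀
  have hbd : ∀ᶠ t in 𝓝 t₀, ‖c t‖ < ‖c t₀‖ + 1 :=
    (hc.continuousAt hnhds).norm.eventually_lt_const (lt_add_one _)
  obtain ⟨a, b, hab, hsub⟩ := mem_nhds_iff_exists_Ioo_subset.1 (hbd.and hnhds)
  have hsub' : ∀ t ∈ Ioo a b, ‖c t‖ < ‖c t₀‖ + 1 ∧ t ∈ Ioo (0 : ℝ) 1 := fun t ht => hsub ht
  refine ⟨a, b, hab.1.trans hab.2, fun t ht => (hsub' t ht).2, ?_⟩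
  have := ODE_solution_unique_of_mem_Ioo (v := fun t x => c t * x) (s := fun _ => univ)
    (K := Real.toNNReal (‖c t₀‖ + 1)) (f := g) (g := fun _ => 0) (a := a) (b := b) (t₀ := t₀)
    (fun t ht => ?_) hab (fun t ht => ⟨hg t (hsub' t ht).2, mem_univ _⟩)
    (fun t _ => ⟨by simpa using hasDerivAt_const t (0 : ℝ), mem_univ _⟩) h0
  · exact this
  · refine LipschitzWith.lipschitzOnWith (LipschitzWith.of_dist_le_mul fun x y => ?_)
    rw [Real.coe_toNNReal _ (by positivity), dist_eq_norm, dist_eq_norm, ← mul_sub, norm_mul]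
    gcongr
    exact (hsub' t ht).1.le

variable [CompleteSpace H]

/-- Pairing the normality condition with a fixed nonzero `f ∈ D` recovers `α'/α` almost everywhere
as a function `c` that is continuous on `(0, 1)`, since `A_r(t) f` is. Thus `α' = c α` on all of
`(0, 1)`, and an interior zero would spread to an interval of zeros, contradicting the null zero
set. -/
theorem StandingAssumptions.isRegularWeight [Nontrivial H]
    (hA : StandingAssumptions α D A Ar Ai C) : IsRegularWeight α := by
  have hdiff : ContDiffOn ℝ 2 α (Ioo 0 1) := hA.weight_contDiff.mono Ioo_subset_Icc_self
  have hderiv : ∀ t ∈ Ioo (0 : ℝ) 1, HasDerivAt α (deriv α t) t := fun t ht =>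
    ((hdiff.contDiffAt (isOpen_Ioo.mem_nhds ht)).differentiableAt two_ne_zero).hasDerivAt
  have hcont : ContinuousOn (deriv α) (Ioo 0 1) :=
    hdiff.continuousOn_deriv_of_isOpen isOpen_Ioo one_le_two
  refine ⟨hA.weight_contDiff.continuousOn, ?_, hderiv, hcont⟩
  obtain ⟨f, hfD, hf0⟩ := hA.dense.exists_mem_open isOpen_ne (exists_ne (0 : H))
  have hfC := hA.le_domain_const hfD
  set c : ℝ → ℝ := fun t => 2 * ((⟪f, app (Ar t) f - app C f⟫_ℂ).re / ‖f‖ ^ 2) with hc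
  have hcc : ContinuousOn c (Ioo 0 1) := by
    have h1 := (hA.real_smooth f hfD).continuousOn
    have h2 : ContinuousOn (fun t => ⟪f, app (Ar t) f - app C f⟫_ℂ) (Ioo 0 1) :=
      continuousOn_const.inner (h1.sub continuousOn_const)
    exact ((Complex.continuous_re.comp_continuousOn h2).div_const _).const_mul _
  have hnz : ∀ᵐ t ∂volume.restrict (Ioo (0 : ℝ) 1), α t ≠ 0 := by
    rw [ae_restrict_iff' measurableSet_Ioo]
    have := measure_eq_zero_iff_ae_notMem.1 hA.weight_zeros
    filter_upwards [this] with t h ht h0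
    exact h ⟨Ioo_subset_Icc_self ht, h0⟩
  have heq : EqOn (deriv α) (fun t => c t * α t) (Ioo 0 1) := by
    refine Measure.eqOn_Ioo_of_ae_eq volume ?_ hcont
      (hcc.mul (hA.weight_contDiff.continuousOn.mono Ioo_subset_Icc_self))
    filter_upwards [hnz, hA.normality] with t h0 h
    rw [hc]
    simp only
    rw [app_real h hfC, add_sub_cancel_right, inner_smul_right, inner_self_eq_norm_sq_to_K]
    have h1 : ‖f‖ ≠ 0 := norm_ne_zero_iff.2 hf0
    have h2 : (((deriv α t / (2 * α t) : ℝ) : ℂ) * ((‖f‖ : ℝ) : ℂ) ^ 2).re =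
      deriv α t / (2 * α t) * ‖f‖ ^ 2 := by norm_cast
    have h3 := congrArg (fun r => 2 * (r / ‖f‖ ^ 2) * α t) h2
    refine Eq.trans ?_ h3.symm
    field_simp
  intro t₀ ht₀
  refine lt_of_le_of_ne (hA.weight_nonneg t₀ (Ioo_subset_Icc_self ht₀)) fun h0 => ?_
  obtain ⟨a, b, hab, hsub, hz⟩ := exists_eqOn_zero_of_deriv_eq hcc
    (fun t ht => (hderiv t ht).congr_deriv (heq ht)) ht₀ h0.symm
  have h1 : volume (Ioo a b) ≤ 0 := by
    rw [← hA.weight_zeros]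
    exact measure_mono fun t ht => ⟨Ioo_subset_Icc_self (hsub ht), hz t ht⟩
  rw [Real.volume_Ioo, nonpos_iff_eq_zero, ENNReal.ofReal_eq_zero] at h1
  linarith

end Weight

/-! ### The weighted measure and its relation to Lebesgue measure -/

section WeightedMeasure

variable {H : Type*} [NormedAddCommGroup H] {α : ℝ → ℝ}

theorem weightedMeasure_absolutelyContinuous :
    weightedMeasure α ≪ volume.restrict (Ioo (0 : ℝ) 1) :=
  withDensity_absolutelyContinuous _ _

namespace IsRegularWeight

theorem aemeasurable (hα : IsRegularWeight α) :
    AEMeasurable (fun t => ENNReal.ofReal (α t)) (volume.restrict (Ioo 0 1)) :=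
  ((hα.continuousOn.mono Ioo_subset_Icc_self).aemeasurable measurableSet_Ioo).ennreal_ofReal

theorem isFiniteMeasure (hα : IsRegularWeight α) : IsFiniteMeasure (weightedMeasure α) :=
  isFiniteMeasure_withDensity_ofReal
    ((hα.continuousOn.integrableOn_Icc).mono_set Ioo_subset_Icc_self).hasFiniteIntegral

theorem absolutelyContinuous (hα : IsRegularWeight α) :
    volume.restrict (Ioo (0 : ℝ) 1) ≪ weightedMeasure α := by
  refine withDensity_absolutelyContinuous' hα.aemeasurable ?_
  filter_upwards [ae_restrict_mem measurableSet_Ioo] with t ht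
  exact (ENNReal.ofReal_pos.2 (hα.pos t ht)).ne'

theorem integral_eq (hα : IsRegularWeight α) {X : Type*} [NormedAddCommGroup X] [NormedSpace ℝ X]
    (g : ℝ → X) : ∫ t, g t ∂weightedMeasure α = ∫ t in Ioo (0 : ℝ) 1, α t • g t := by
  rw [weightedMeasure, integral_withDensity_eq_integral_toReal_smul₀ hα.aemeasurable
    (Eventually.of_forall fun _ => ENNReal.ofReal_lt_top)]
  refine setIntegral_congr_fun measurableSet_Ioo fun t ht => ?_
  rw [ENNReal.toReal_ofReal (hα.pos t ht).le]

theorem integrable_iff (hα : IsRegularWeight α) {X : Type*} [NormedAddCommGroup X]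
    [NormedSpace ℝ X] {g : ℝ → X} :
    Integrable g (weightedMeasure α) ↔ IntegrableOn (fun t => α t • g t) (Ioo (0 : ℝ) 1) := by
  rw [weightedMeasure, integrable_withDensity_iff_integrable_smul₀' hα.aemeasurable
    (Eventually.of_forall fun _ => ENNReal.ofReal_lt_top), IntegrableOn]
  refine integrable_congr ?_
  filter_upwards [ae_restrict_mem measurableSet_Ioo] with t ht
  rw [ENNReal.toReal_ofReal (hα.pos t ht).le]

/-- The unitary equivalence of the weighted space with the unweighted one, on functions. -/
theorem memLp_iff [NormedSpace ℂ H] (hα : IsRegularWeight α) {u : ℝ → H} :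
    MemLp u 2 (weightedMeasure α) ↔
      MemLp (fun t => ((√(α t) : ℝ) : ℂ) • u t) 2 (volume.restrict (Ioo (0 : ℝ) 1)) := by
  have hs : ContinuousOn (fun t => ((√(α t) : ℝ) : ℂ)) (Ioo 0 1) :=
    Complex.continuous_ofReal.comp_continuousOn (hα.continuousOn.mono Ioo_subset_Icc_self).sqrt
  have hne : ∀ t ∈ Ioo (0 : ℝ) 1, ((√(α t) : ℝ) : ℂ) ≠ 0 := fun t ht => by
    exact_mod_cast (Real.sqrt_pos.2 (hα.pos t ht)).ne'
  have key : ∀ v : ℝ → H, ∀ t ∈ Ioo (0 : ℝ) 1,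
      α t • ‖v t‖ ^ 2 = ‖((√(α t) : ℝ) : ℂ) • v t‖ ^ 2 := fun v t ht => by
    rw [norm_smul, mul_pow, Complex.norm_real, Real.norm_of_nonneg (Real.sqrt_nonneg _),
      Real.sq_sqrt (hα.pos t ht).le, smul_eq_mul]
  have hcongr : IntegrableOn (fun t => α t • ‖u t‖ ^ 2) (Ioo (0 : ℝ) 1) ↔
      IntegrableOn (fun t => ‖((√(α t) : ℝ) : ℂ) • u t‖ ^ 2) (Ioo (0 : ℝ) 1) :=
    integrableOn_congr_fun (key u) measurableSet_Ioo
  constructor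
  · intro h
    have h1 : AEStronglyMeasurable u (volume.restrict (Ioo (0 : ℝ) 1)) :=
      h.1.mono_ac hα.absolutelyContinuous
    have h2 : AEStronglyMeasurable (fun t => ((√(α t) : ℝ) : ℂ) • u t)
        (volume.restrict (Ioo (0 : ℝ) 1)) := (hs.aestronglyMeasurable measurableSet_Ioo).smul h1
    refine (memLp_two_iff_integrable_sq_norm h2).2 ?_
    rw [memLp_two_iff_integrable_sq_norm h.1, hα.integrable_iff, hcongr] at h
    exact h
  · intro h
    have h1 : AEStronglyMeasurable u (weightedMeasure α) := by
      refine (((hs.inv₀ hne).aestronglyMeasurable measurableSet_Ioo).smul h.1).congr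
        ?_ |>.mono_ac weightedMeasure_absolutelyContinuous
      filter_upwards [ae_restrict_mem measurableSet_Ioo] with t ht
      exact inv_smul_smul₀ (hne t ht) _
    rw [memLp_two_iff_integrable_sq_norm h1, hα.integrable_iff, hcongr]
    exact (memLp_two_iff_integrable_sq_norm h.1).1 h

end IsRegularWeight

theorem continuous_of_continuousOn_of_eq_zero {X : Type*} [TopologicalSpace X] [Zero X]
    {S K : Set ℝ} (hS : IsOpen S) (hK : IsCompact K) (hKS : K ⊆ S) {G : ℝ → X}
    (hG : ContinuousOn G S) (h0 : ∀ t ∉ K, G t = 0) : Continuous G := by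
  rw [continuous_iff_continuousAt]
  intro t
  by_cases ht : t ∈ K
  · exact hG.continuousAt (hS.mem_nhds (hKS ht))
  · refine continuousAt_const.congr (?_ : (fun _ => (0 : X)) =ᶠ[𝓝 t] G)
    filter_upwards [hK.isClosed.isOpen_compl.mem_nhds ht] with s hs
    exact (h0 s hs).symm

end WeightedMeasure

/-! ### The joint eigenbasis and its transport by the evolution -/

section Eigenbasis

variable {H : Type*} [NormedAddCommGroup H] [InnerProductSpace ℂ H]
  {α : ℝ → ℝ} {D : Submodule ℂ H} {A Ar Ai : ℝ → H →ₗ.[ℂ] H} {C : H →ₗ.[ℂ] H}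
  {K W : H →L[ℂ] H} {ι : Type*} {b : HilbertBasis ι ℂ H} {lam : ι → ℝ} {ζ : ι → ℂ}

/-- A Hilbert basis of joint eigenvectors of `K⁻¹` and `W`, where the eigenvalues of `K⁻¹` are
positive and tend to infinity. -/
structure IsEigenbasis (K W : H →L[ℂ] H) (b : HilbertBasis ι ℂ H) (lam : ι → ℝ) (ζ : ι → ℂ) :
    Prop where
  pos : ∀ i, 0 < lam i
  inv_apply : ∀ i, K (b i) = ((lam i : ℂ))⁻¹ • b i
  unitary_apply : ∀ i, W (b i) = ζ i • b i
  finite : ∀ x, {i | lam i ≤ x}.Finite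

theorem HilbertBasis.eq_zero_of_inner_eq_zero (b : HilbertBasis ι ℂ H) {x : H}
    (h : ∀ i, ⟪b i, x⟫_ℂ = 0) : x = 0 := by
  have h1 := b.hasSum_repr x
  have h2 : ∀ i, b.repr x i • b i = 0 := fun i => by rw [b.repr_apply_apply, h, zero_smul]
  simp only [h2] at h1
  exact (hasSum_zero.unique h1).symm

theorem HilbertBasis.hasSum_inner_smul (b : HilbertBasis ι ℂ H) (x : H) :
    HasSum (fun i => ⟪b i, x⟫_ℂ • b i) x := by
  simpa only [b.repr_apply_apply] using b.hasSum_repr x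

variable [CompleteSpace H]

/-- The eigenvalues of `K` are real by symmetry, nonnegative because `C ≥ 0`, and nonzero by
injectivity, so `λ` may be taken as their reciprocals; compactness of `K` bounds how many can stay
below a given level. -/
theorem exists_isEigenbasis (hC : IsSelfAdjoint C)
    (hC0 : ∀ x : C.domain, 0 ≤ (inner ℂ (C x) (x : H)).re)
    (hK : IsResolventAt C 0 K) (hc : IsCompactOperator K)
    (hW : W ∈ unitary (H →L[ℂ] H)) (hCW : CommutesWith W C) :
    ∃ (ι : Type) (b : HilbertBasis ι ℂ H) (lam : ι → ℝ) (ζ : ι → ℂ),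
      IsEigenbasis K W b lam ζ := by
  have hsymm := hK.isSymmetric hC
  have hKW : ∀ x, K (W x) = W (K x) := by
    intro x
    obtain ⟨h1, h2⟩ := hCW ⟨K x, hK.apply_mem x⟩
    rw [← app_eq h1, ← app_eq (hK.apply_mem x), hK.app_apply] at h2
    rw [← h2]
    exact hK.apply_app h1
  obtain ⟨ι, b, κ, ζ, h⟩ := exists_joint_eigenbasis hc hsymm (fun x hx => hK.injective hx) hW hKW
  have hb1 : ∀ i, ⟪b i, b i⟫_ℂ = 1 := fun i => by
    rw [inner_self_eq_norm_sq_to_K, b.orthonormal.1]; simp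
  have hb0 : ∀ i, b i ≠ 0 := b.orthonormal.ne_zero
  have hκ0 : ∀ i, κ i ≠ 0 := fun i h0 => by
    have := (h i).1
    rw [h0, zero_smul] at this
    exact hb0 i (hK.injective this)
  have hreal : ∀ i, ((κ i).re : ℂ) = κ i := fun i => by
    have h1 := hsymm (b i) (b i)
    change ⟪K (b i), b i⟫_ℂ = ⟪b i, K (b i)⟫_ℂ at h1
    rw [(h i).1, inner_smul_left, inner_smul_right, hb1, mul_one, mul_one] at h1
    exact Complex.conj_eq_iff_re.1 h1
  have hnn : ∀ i, 0 ≤ (κ i).re := fun i => by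
    have h1 := hC0 ⟨K (b i), hK.apply_mem _⟩
    rw [← app_eq (hK.apply_mem _), hK.app_apply] at h1
    simp only at h1
    rwa [(h i).1, inner_smul_right, hb1, mul_one] at h1
  have hpos : ∀ i, 0 < (κ i).re := fun i =>
    lt_of_le_of_ne (hnn i) fun h0 => hκ0 i (by rw [← hreal, ← h0, Complex.ofReal_zero])
  refine ⟨ι, b, fun i => ((κ i).re)⁻¹, ζ, fun i => inv_pos.2 (hpos i), fun i => ?_,
    fun i => (h i).2, fun x => ?_⟩
  · rw [Complex.ofReal_inv, inv_inv, hreal, (h i).1]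
  -- Replacing `x` by `max x 1` keeps the threshold positive when `x ≤ 0`.
  · refine (finite_setOf_le_norm_eigenvalue hc b.orthonormal (fun i => (h i).1)
      (ε := (max x 1)⁻¹) (by positivity)).subset fun i hi => ?_
    have h1 : ((κ i).re)⁻¹ ≤ max x 1 := le_max_of_le_left hi
    have h2 : (max x 1)⁻¹ ≤ (κ i).re := inv_le_of_inv_le₀ (hpos i) h1
    exact h2.trans ((le_abs_self _).trans (Complex.abs_re_le_norm _))

namespace IsEigenbasis

omit [CompleteSpace H] in
theorem countable (hb : IsEigenbasis K W b lam ζ) : Countable ι := by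
  have : (⋃ n : ℕ, {i | lam i ≤ n}) = univ := by
    refine eq_univ_of_forall fun i => mem_iUnion.2 ?_
    exact exists_nat_ge (lam i)
  rw [← Set.countable_univ_iff, ← this]
  exact countable_iUnion fun n => (hb.finite n).countable

omit [CompleteSpace H] in
theorem mem_eigenspace (hb : IsEigenbasis K W b lam ζ) (i : ι) :
    b i ∈ Module.End.eigenspace (K : Module.End ℂ H) ((lam i : ℂ))⁻¹ :=
  Module.End.mem_eigenspace_iff.2 (hb.inv_apply i)

omit [CompleteSpace H] in
theorem inv_ne_zero (hb : IsEigenbasis K W b lam ζ) (i : ι) : ((lam i : ℂ))⁻¹ ≠ 0 :=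
  _root_.inv_ne_zero (by exact_mod_cast (hb.pos i).ne')

theorem mem_domain (hA : StandingAssumptions α D A Ar Ai C) (hK : IsResolventAt C 0 K)
    (hc : IsCompactOperator K) (hb : IsEigenbasis K W b lam ζ) (i : ι) : b i ∈ D := by
  have := ContinuousLinearMap.finite_dimensional_eigenspace hc _ (hb.inv_ne_zero i)
  exact hA.eigenspace_le hK (hb.inv_ne_zero i) (hb.mem_eigenspace i)

theorem evolution_mem (hA : StandingAssumptions α D A Ar Ai C) (hK : IsResolventAt C 0 K)
    (hc : IsCompactOperator K) (hb : IsEigenbasis K W b lam ζ) {U : ℝ → ℝ → H →L[ℂ] H}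
    (hU : IsEvolutionFamily D Ai U) (i : ι) {t : ℝ} (ht : t ∈ Icc (0 : ℝ) 1) :
    U t 0 (b i) ∈ D ∧ app C (U t 0 (b i)) = (lam i : ℂ) • U t 0 (b i) := by
  have := ContinuousLinearMap.finite_dimensional_eigenspace hc _ (hb.inv_ne_zero i)
  have h1 := hA.evolution_mem_eigenspace hK hU (hb.inv_ne_zero i) ht (hb.mem_eigenspace i)
  refine ⟨hA.eigenspace_le hK (hb.inv_ne_zero i) h1, ?_⟩
  have h2 : K (U t 0 (b i)) = ((lam i : ℂ))⁻¹ • U t 0 (b i) := Module.End.mem_eigenspace_iff.1 h1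
  have h3 : U t 0 (b i) = (lam i : ℂ) • K (U t 0 (b i)) := by
    rw [h2, smul_inv_smul₀ (by exact_mod_cast (hb.pos i).ne')]
  conv_lhs => rw [h3]
  rw [app_smul _ (hK.apply_mem _), hK.app_apply]

/-- The images of the basis vectors under the evolution operators are total. -/
theorem eq_zero_of_inner_evolution_eq_zero (hA : StandingAssumptions α D A Ar Ai C)
    (hK : IsResolventAt C 0 K) (hc : IsCompactOperator K) (hb : IsEigenbasis K W b lam ζ)
    {U : ℝ → ℝ → H →L[ℂ] H} (hU : IsEvolutionFamily D Ai U) {t : ℝ} (ht : t ∈ Icc (0 : ℝ) 1)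
    {v : H} (hv : ∀ i, ⟪U t 0 (b i), v⟫_ℂ = 0) : v = 0 := by
  have h1 : ∀ x, ⟪v, U t 0 x⟫_ℂ = 0 := by
    intro x
    have h2 := ((innerSL ℂ v).comp (U t 0)).hasSum (HilbertBasis.hasSum_inner_smul b x)
    have h3 : ∀ i, ((innerSL ℂ v).comp (U t 0)) (⟪b i, x⟫_ℂ • b i) = 0 := by
      intro i
      rw [map_smul]
      change _ • ⟪v, U t 0 (b i)⟫_ℂ = 0
      rw [← inner_conj_symm v, hv, map_zero, smul_zero]
    simp only [h3] at h2
    exact (hasSum_zero.unique h2).symm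
  refine HilbertBasis.eq_zero_of_inner_eq_zero b fun i => ?_
  have := ContinuousLinearMap.finite_dimensional_eigenspace hc _ (hb.inv_ne_zero i)
  set F := Module.End.eigenspace (K : Module.End ℂ H) ((lam i : ℂ))⁻¹
  -- Surjectivity of `U t 0` is not assumed. On the finite-dimensional `F` it preserves inner
  -- products, hence is injective and therefore onto, so `b i` lies in its range.
  have hmaps : ∀ x ∈ F, (U t 0 : H →ₗ[ℂ] H) x ∈ F := fun x hx =>
    hA.evolution_mem_eigenspace hK hU (hb.inv_ne_zero i) ht hx
  have hinj : Function.Injective ((U t 0 : H →ₗ[ℂ] H).restrict hmaps) := by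
    rw [injective_iff_map_eq_zero]
    rintro ⟨x, hx⟩ h
    have hxD := hA.eigenspace_le hK (hb.inv_ne_zero i) hx
    have h1 : U t 0 x = 0 := congrArg Subtype.val h
    have h2 := hA.inner_evolution_eq hU hxD hxD ht
    rw [h1, inner_zero_left, eq_comm, inner_self_eq_zero] at h2
    exact Subtype.ext h2
  obtain ⟨y, hy⟩ := LinearMap.surjective_of_injective hinj ⟨b i, hb.mem_eigenspace i⟩
  have h2 : U t 0 (y : H) = b i := congrArg Subtype.val hy
  rw [← h2, ← inner_conj_symm, h1, map_zero]

end IsEigenbasis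

end Eigenbasis

/-! ### An orthonormal and total family of eigenfunctions -/

section Modes

variable {H : Type*} [NormedAddCommGroup H] [InnerProductSpace ℂ H] [CompleteSpace H]
  {α : ℝ → ℝ} {D : Submodule ℂ H} {A Ar Ai : ℝ → H →ₗ.[ℂ] H} {C : H →ₗ.[ℂ] H}
  {K W : H →L[ℂ] H} {ι : Type*} {b : HilbertBasis ι ℂ H} {lam : ι → ℝ} {ζ : ι → ℂ}
  {U : ℝ → ℝ → H →L[ℂ] H}

/-- The frequencies `θ` with `exp (i θ) = ζ`. -/
def frequency (ζ : ι → ℂ) (p : ι × ℤ) : ℝ := (ζ p.1).arg + 2 * Real.pi * p.2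

/-- The functions `exp (i θ t) U(t, 0) e`. -/
def mode (U : ℝ → ℝ → H →L[ℂ] H) (b : HilbertBasis ι ℂ H) (ζ : ι → ℂ) (p : ι × ℤ) (t : ℝ) : H :=
  Complex.exp (Complex.I * frequency ζ p * t) • U t 0 (b p.1)

/-- Eigenfunctions of `l` and `l⁺`, multiplied by the square root of the weight. -/
structure IsMode (D : Submodule ℂ H) (Ai : ℝ → H →ₗ.[ℂ] H) (C : H →ₗ.[ℂ] H) (lam : ℝ) (η : ℂ)
    (w : ℝ → H) : Prop where
  mem : ∀ t ∈ Icc (0 : ℝ) 1, w t ∈ D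
  app_const : ∀ t ∈ Icc (0 : ℝ) 1, app C (w t) = (lam : ℂ) • w t
  hasDeriv : ∀ t ∈ Icc (0 : ℝ) 1,
    HasDerivWithinAt w (η • w t - Complex.I • app (Ai t) (w t)) (Icc 0 1) t

omit [CompleteSpace H] in
theorem IsMode.continuousOn {lam : ℝ} {η : ℂ} {w : ℝ → H} (hw : IsMode D Ai C lam η w) :
    ContinuousOn w (Icc 0 1) := fun t ht => (hw.hasDeriv t ht).continuousWithinAt

theorem isMode_mode (hA : StandingAssumptions α D A Ar Ai C) (hK : IsResolventAt C 0 K)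
    (hc : IsCompactOperator K) (hb : IsEigenbasis K W b lam ζ)
    (hU : IsEvolutionFamily D Ai U) (p : ι × ℤ) :
    IsMode D Ai C (lam p.1) (Complex.I * frequency ζ p) (mode U b ζ p) := by
  have hm := fun t ht => hb.evolution_mem hA hK hc hU p.1 (t := t) ht
  refine ⟨fun t ht => D.smul_mem _ (hm t ht).1, fun t ht => ?_, fun t ht => ?_⟩
  · rw [mode, app_smul _ (hA.le_domain_const (hm t ht).1), (hm t ht).2, smul_comm]
  · have h1 := hU.equation t ht 0 ⟨le_rfl, zero_le_one⟩ _ (hb.mem_domain hA hK hc p.1)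
    have h2 : HasDerivWithinAt (fun s : ℝ => Complex.exp (Complex.I * frequency ζ p * s))
        (Complex.exp (Complex.I * frequency ζ p * t) * (Complex.I * frequency ζ p)) (Icc 0 1) t := by
      have h3 : HasDerivAt (fun s : ℂ => Complex.exp (Complex.I * frequency ζ p * s))
          (Complex.exp (Complex.I * frequency ζ p * t) * (Complex.I * frequency ζ p)) (t : ℂ) := by
        simpa using ((hasDerivAt_id (t : ℂ)).const_mul (Complex.I * frequency ζ p)).cexp
      exact h3.comp_ofReal.hasDerivWithinAt
    refine (h2.smul h1).congr_deriv ?_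
    rw [mode, app_smul _ ((hA.mem_iff ht).1 (hm t ht).1).2]
    rw [smul_neg, smul_smul, smul_smul, smul_smul, mul_comm Complex.I (Complex.exp _),
      mul_comm (Complex.exp _) (Complex.I * (frequency ζ p : ℂ))]
    abel

theorem inner_mode (hA : StandingAssumptions α D A Ar Ai C) (hK : IsResolventAt C 0 K)
    (hc : IsCompactOperator K) (hb : IsEigenbasis K W b lam ζ)
    (hU : IsEvolutionFamily D Ai U) (p q : ι × ℤ) {t : ℝ} (ht : t ∈ Icc (0 : ℝ) 1) :
    ⟪mode U b ζ p t, mode U b ζ q t⟫_ℂ =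
      Complex.exp (Complex.I * ((frequency ζ q - frequency ζ p : ℝ) : ℂ) * t) *
        ⟪b p.1, b q.1⟫_ℂ := by
  rw [mode, mode, inner_smul_left, inner_smul_right,
    hA.inner_evolution_eq hU (hb.mem_domain hA hK hc _) (hb.mem_domain hA hK hc _) ht,
    ← Complex.exp_conj, ← mul_assoc, ← Complex.exp_add]
  congr 2
  simp only [map_mul, Complex.conj_I, Complex.conj_ofReal, Complex.ofReal_sub]
  ring

theorem norm_mode (hA : StandingAssumptions α D A Ar Ai C) (hK : IsResolventAt C 0 K)
    (hc : IsCompactOperator K) (hb : IsEigenbasis K W b lam ζ)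
    (hU : IsEvolutionFamily D Ai U) (p : ι × ℤ) {t : ℝ} (ht : t ∈ Icc (0 : ℝ) 1) :
    ‖mode U b ζ p t‖ = 1 := by
  have h1 := inner_mode hA hK hc hb hU p p ht
  rw [inner_self_eq_norm_sq_to_K, inner_self_eq_norm_sq_to_K, b.orthonormal.1, sub_self] at h1
  simp only [Complex.ofReal_zero, mul_zero, zero_mul, Complex.exp_zero, one_mul] at h1
  have h2 : ‖mode U b ζ p t‖ ^ 2 = 1 := by
    have h3 : ((‖mode U b ζ p t‖ : ℝ) : ℂ) ^ 2 = 1 := by simpa using h1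
    exact_mod_cast h3
  exact (pow_eq_one_iff_of_nonneg (norm_nonneg _) two_ne_zero).1 h2

/-- The eigenfunction of the weighted problem which belongs to a function `w`. -/
def unweight (α : ℝ → ℝ) (w : ℝ → H) (t : ℝ) : H := ((√(α t) : ℝ) : ℂ)⁻¹ • w t

omit [CompleteSpace H] in
theorem sqrt_smul_unweight (hα : IsRegularWeight α) (w : ℝ → H) {t : ℝ} (ht : t ∈ Ioo (0 : ℝ) 1) :
    ((√(α t) : ℝ) : ℂ) • unweight α w t = w t :=
  smul_inv_smul₀ (by exact_mod_cast (Real.sqrt_pos.2 (hα.pos t ht)).ne') _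

omit [CompleteSpace H] in
theorem memLp_unweight (hα : IsRegularWeight α) {w : ℝ → H} (hw : ContinuousOn w (Icc 0 1)) :
    MemLp (unweight α w) 2 (weightedMeasure α) := by
  rw [hα.memLp_iff]
  have h1 : MemLp w 2 (volume.restrict (Ioo (0 : ℝ) 1)) := by
    obtain ⟨M, hM⟩ := isCompact_Icc.exists_bound_of_continuousOn hw
    refine MemLp.of_bound ((hw.mono Ioo_subset_Icc_self).aestronglyMeasurable measurableSet_Ioo) M ?_
    filter_upwards [ae_restrict_mem measurableSet_Ioo] with t ht
    exact hM t (Ioo_subset_Icc_self ht)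
  refine h1.ae_eq ?_
  filter_upwards [ae_restrict_mem measurableSet_Ioo] with t ht
  exact (sqrt_smul_unweight hα w ht).symm

omit [CompleteSpace H] in
/-- The scalar product with the eigenfunction which belongs to `w`. -/
theorem inner_unweight (hα : IsRegularWeight α) {w g : ℝ → H} {u v : WeightedL2 H α}
    (hu : u =ᵐ[weightedMeasure α] unweight α w) (hv : v =ᵐ[weightedMeasure α] g) :
    ⟪u, v⟫_ℂ = ∫ t in Ioo (0 : ℝ) 1, √(α t) • ⟪w t, g t⟫_ℂ := by
  rw [L2.inner_def]
  have h1 : ∫ t, ⟪u t, v t⟫_ℂ ∂weightedMeasure α =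
      ∫ t, ⟪unweight α w t, g t⟫_ℂ ∂weightedMeasure α := by
    refine integral_congr_ae ?_
    filter_upwards [hu, hv] with t h1 h2
    rw [h1, h2]
  rw [h1, hα.integral_eq]
  refine setIntegral_congr_fun measurableSet_Ioo fun t ht => ?_
  have hs := Real.sqrt_pos.2 (hα.pos t ht)
  simp only [unweight]
  rw [inner_smul_left, map_inv₀, Complex.conj_ofReal, Complex.real_smul, Complex.real_smul,
    ← mul_assoc]
  congr 1
  rw [← div_eq_mul_inv, div_eq_iff (by exact_mod_cast hs.ne')]
  exact_mod_cast (Real.mul_self_sqrt (hα.pos t ht).le).symm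

/-- The normalized eigenfunctions. -/
def modeLp (hα : IsRegularWeight α) {w : ℝ → H} (hw : ContinuousOn w (Icc 0 1)) :
    WeightedL2 H α := (memLp_unweight hα hw).toLp

omit [CompleteSpace H] in
theorem coeFn_modeLp (hα : IsRegularWeight α) {w : ℝ → H} (hw : ContinuousOn w (Icc 0 1)) :
    modeLp hα hw =ᵐ[weightedMeasure α] unweight α w := MemLp.coeFn_toLp _

theorem integral_exp_frequency (ζ : ι → ℂ) (i : ι) (k l : ℤ) :
    ∫ t in Ioo (0 : ℝ) 1,
      Complex.exp (Complex.I * ((frequency ζ (i, l) - frequency ζ (i, k) : ℝ) : ℂ) * t) =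
        if k = l then 1 else 0 := by
  split_ifs with h
  · simp [h]
  · have hc : (2 * Real.pi * Complex.I * (l - k : ℤ) : ℂ) ≠ 0 := by
      have : (l - k : ℤ) ≠ 0 := sub_ne_zero.2 (Ne.symm h)
      exact mul_ne_zero Complex.two_pi_I_ne_zero (by exact_mod_cast this)
    have h1 : ∀ t : ℝ, Complex.exp (Complex.I *
        ((frequency ζ (i, l) - frequency ζ (i, k) : ℝ) : ℂ) * t) =
        Complex.exp ((2 * Real.pi * Complex.I * (l - k : ℤ)) * t) := by
      intro t
      congr 1
      simp only [frequency]
      push_cast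
      ring
    simp only [h1]
    rw [← integral_Ioc_eq_integral_Ioo, ← intervalIntegral.integral_of_le zero_le_one,
      integral_exp_mul_complex hc]
    have h2 : Complex.exp (2 * Real.pi * Complex.I * (l - k : ℤ)) = 1 := by
      rw [mul_comm, Complex.exp_int_mul_two_pi_mul_I]
    rw [Complex.ofReal_one, mul_one, h2]
    simp

/-- The weight cancels, and the evolution preserves inner products on `D`. Different basis vectors
are thus orthogonal at each `t`; for equal ones the exponentials `exp(2πi(l - k)t)` remain. -/
theorem orthonormal_modeLp (hα : IsRegularWeight α) (hA : StandingAssumptions α D A Ar Ai C)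
    (hK : IsResolventAt C 0 K) (hc : IsCompactOperator K) (hb : IsEigenbasis K W b lam ζ)
    (hU : IsEvolutionFamily D Ai U) :
    Orthonormal ℂ fun p => modeLp hα (isMode_mode hA hK hc hb hU p).continuousOn := by
  classical
  rw [orthonormal_iff_ite]
  intro p q
  rw [inner_unweight hα (coeFn_modeLp hα _) (coeFn_modeLp hα _)]
  have h1 : ∫ t in Ioo (0 : ℝ) 1, √(α t) • ⟪mode U b ζ p t, unweight α (mode U b ζ q) t⟫_ℂ =
      ∫ t in Ioo (0 : ℝ) 1,
        Complex.exp (Complex.I * ((frequency ζ q - frequency ζ p : ℝ) : ℂ) * t) *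
          ⟪b p.1, b q.1⟫_ℂ := by
    refine setIntegral_congr_fun measurableSet_Ioo fun t ht => ?_
    rw [← inner_mode hA hK hc hb hU p q (Ioo_subset_Icc_self ht), Complex.real_smul,
      ← inner_smul_right, sqrt_smul_unweight hα _ ht]
  rw [h1, integral_mul_const, orthonormal_iff_ite.1 b.orthonormal]
  obtain ⟨i, k⟩ := p
  obtain ⟨j, l⟩ := q
  by_cases hij : i = j
  · subst hij
    rw [integral_exp_frequency]
    simp
  · simp [hij]

/-- For fixed `i`, orthogonality to all modes `(i, k)` says that every Fourier coefficient of `⟪mode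
(i, 0), √α u⟫` vanishes, so this function is zero almost everywhere. Countability of the basis gives
one null set for all `i`, and the vectors `U(t,0) (b i)` are total at each `t`. -/
theorem modeLp_total (hα : IsRegularWeight α) (hA : StandingAssumptions α D A Ar Ai C)
    (hK : IsResolventAt C 0 K) (hc : IsCompactOperator K) (hb : IsEigenbasis K W b lam ζ)
    (hU : IsEvolutionFamily D Ai U) {u : WeightedL2 H α}
    (hu : ∀ p, ⟪modeLp hα (isMode_mode hA hK hc hb hU p).continuousOn, u⟫_ℂ = 0) : u = 0 := by
  have := hb.countable
  set v : ℝ → H := fun t => ((√(α t) : ℝ) : ℂ) • u t with hv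
  have hvL : MemLp v 2 (volume.restrict (Ioo (0 : ℝ) 1)) := hα.memLp_iff.1 (Lp.memLp u)
  have key : ∀ i, ∀ᵐ t ∂volume.restrict (Ioo (0 : ℝ) 1), ⟪mode U b ζ (i, 0) t, v t⟫_ℂ = 0 := by
    intro i
    have hcont := (isMode_mode hA hK hc hb hU (i, 0)).continuousOn.mono Ioo_subset_Icc_self
    have hL : MemLp (fun t => ⟪mode U b ζ (i, 0) t, v t⟫_ℂ) 2
        (volume.restrict (Ioo (0 : ℝ) 1)) := by
      refine hvL.of_le ((hcont.aestronglyMeasurable measurableSet_Ioo).inner hvL.1) ?_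
      filter_upwards [ae_restrict_mem measurableSet_Ioo] with t ht
      refine (norm_inner_le_norm _ _).trans ?_
      rw [norm_mode hA hK hc hb hU _ (Ioo_subset_Icc_self ht), one_mul]
    have hL' : MemLp (fun t => ⟪mode U b ζ (i, 0) t, v t⟫_ℂ) 2
        (volume.restrict (Ioc (0 : ℝ) 1)) := by
      rwa [← restrict_Ioo_eq_restrict_Ioc]
    have hcoef : ∀ k : ℤ, fourierCoeffOn zero_lt_one
        (fun t => ⟪mode U b ζ (i, 0) t, v t⟫_ℂ) k = 0 := by
      intro k
      have h1 := hu (i, k)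
      rw [inner_unweight hα (coeFn_modeLp hα _) (ae_eq_refl (u : ℝ → H))] at h1
      rw [fourierCoeffOn_eq_integral, intervalIntegral.integral_of_le zero_le_one,
        integral_Ioc_eq_integral_Ioo]
      have h2 : ∫ t in Ioo (0 : ℝ) 1, fourier (-k) (t : AddCircle (1 - 0 : ℝ)) •
          ⟪mode U b ζ (i, 0) t, v t⟫_ℂ = 0 := by
        rw [← h1]
        refine setIntegral_congr_fun measurableSet_Ioo fun t ht => ?_
        simp only [hv, mode]
        rw [fourier_coe_apply, inner_smul_right, inner_smul_left, inner_smul_left,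
          Complex.real_smul, smul_eq_mul, ← Complex.exp_conj, ← Complex.exp_conj]
        have e : Complex.exp ((starRingEnd ℂ) (Complex.I * frequency ζ (i, k) * t)) =
            Complex.exp (2 * Real.pi * Complex.I * ((-k : ℤ) : ℂ) * t / ((1 - 0 : ℝ) : ℂ)) *
              Complex.exp ((starRingEnd ℂ) (Complex.I * frequency ζ (i, 0) * t)) := by
          rw [← Complex.exp_add]
          congr 1
          simp only [map_mul, Complex.conj_I, Complex.conj_ofReal, frequency]
          push_cast
          ring
        rw [e]
        ring
      rw [h2, smul_zero]
    have hsum := hasSum_sq_fourierCoeffOn zero_lt_one hL'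
    simp only [hcoef, norm_zero, ne_eq, OfNat.ofNat_ne_zero, not_false_eq_true, zero_pow,
      sub_zero, inv_one, one_smul] at hsum
    have hint := (hasSum_zero.unique hsum).symm
    rw [intervalIntegral.integral_of_le zero_le_one, integral_Ioc_eq_integral_Ioo,
      integral_eq_zero_iff_of_nonneg (fun t => by positivity)
        ((memLp_two_iff_integrable_sq_norm hL.1).1 hL)] at hint
    filter_upwards [hint] with t ht
    simpa using ht
  have hv0 : ∀ᵐ t ∂volume.restrict (Ioo (0 : ℝ) 1), u t = 0 := by
    filter_upwards [ae_all_iff.2 key, ae_restrict_mem measurableSet_Ioo] with t h ht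
    have h1 : v t = 0 := by
      refine hb.eq_zero_of_inner_evolution_eq_zero hA hK hc hU (Ioo_subset_Icc_self ht) fun i => ?_
      have h2 := h i
      rw [mode, inner_smul_left] at h2
      exact (mul_eq_zero.1 h2).resolve_left
        ((map_ne_zero _).2 (Complex.exp_ne_zero _))
    refine (smul_eq_zero.1 h1).resolve_left ?_
    exact_mod_cast (Real.sqrt_pos.2 (hα.pos t ht)).ne'
  exact (Lp.eq_zero_iff_ae_eq_zero).2 (weightedMeasure_absolutelyContinuous.ae_le hv0)

end Modes

/-! ### Adjoints computed on generators of a graph -/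

section AdjointOfGraph

variable {E : Type*} [NormedAddCommGroup E] [InnerProductSpace ℂ E] [CompleteSpace E]

/-- The adjoint of the closure of the operator whose graph is spanned by `S`. -/
theorem adjoint_closure_span_apply {S : Set (E × E)}
    (hd : Dense ((Submodule.span ℂ S).map (LinearMap.fst ℂ E E) : Set E))
    (hS : ∀ p ∈ Submodule.span ℂ S, p.1 = 0 → p.2 = 0) {u g : E}
    (h : ∀ p ∈ S, ⟪g, p.1⟫_ℂ = ⟪u, p.2⟫_ℂ) :
    ∃ hu : u ∈ ((Submodule.span ℂ S).toLinearPMap.closure)†.domain,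
      ((Submodule.span ℂ S).toLinearPMap.closure)† ⟨u, hu⟩ = g := by
  set T := (Submodule.span ℂ S).toLinearPMap with hT
  have hgraph : T.graph = Submodule.span ℂ S := Submodule.toLinearPMap_graph_eq _ hS
  have hspan : ∀ p ∈ Submodule.span ℂ S, ⟪g, p.1⟫_ℂ = ⟪u, p.2⟫_ℂ := by
    intro p hp
    induction hp using Submodule.span_induction with
    | mem p hp => exact h p hp
    | zero => simp
    | add p q _ _ h1 h2 => rw [Prod.fst_add, Prod.snd_add, inner_add_right, inner_add_right, h1, h2]
    | smul c p _ h1 => rw [Prod.smul_fst, Prod.smul_snd, inner_smul_right, inner_smul_right, h1]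
  have hcl : ∀ x : T.closure.domain, ⟪g, (x : E)⟫_ℂ = ⟪u, T.closure x⟫_ℂ := by
    intro x
    have hx := T.closure.mem_graph x
    have hmem : ((x : E), T.closure x) ∈ closure (T.graph : Set (E × E)) := by
      -- For a non-closable operator `closure` returns the operator itself, so its graph lies in the
      -- closed graph in either case.
      by_cases hc : T.IsClosable
      · rw [← Submodule.topologicalClosure_coe, hc.graph_closure_eq_closure_graph]
        exact hx
      · refine subset_closure ?_
        have e : T.closure.graph = T.graph := by rw [LinearPMap.closure_def' hc]
        exact e ▸ hx
    rw [hgraph] at hmem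
    have hclosed : IsClosed {p : E × E | ⟪g, p.1⟫_ℂ = ⟪u, p.2⟫_ℂ} :=
      isClosed_eq (by fun_prop) (by fun_prop)
    exact closure_minimal (fun p hp => hspan p hp) hclosed hmem
  have hdense : Dense (T.closure.domain : Set E) := hd.mono T.le_closure.1
  exact ⟨LinearPMap.mem_adjoint_domain_of_exists u ⟨g, hcl⟩,
    LinearPMap.adjoint_apply_eq hdense _ hcl⟩

end AdjointOfGraph

/-! ### Eigenfunctions and spectrum of the boundary value problem -/

section Eigenfunctions

variable {H : Type*} [NormedAddCommGroup H] [InnerProductSpace ℂ H] [CompleteSpace H]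
  {α : ℝ → ℝ} {D : Submodule ℂ H} {A Ar Ai : ℝ → H →ₗ.[ℂ] H} {C : H →ₗ.[ℂ] H}
  {φ : ℝ → ℂ} {f : H}

/-- The values on `φ f` of the skew-symmetric part of `l`. -/
def skewPart (α : ℝ → ℝ) (Ai : ℝ → H →ₗ.[ℂ] H) (φ : ℝ → ℂ) (f : H) (t : ℝ) : H :=
  (deriv φ t + φ t * ((deriv α t / (2 * α t) : ℝ) : ℂ)) • f + (Complex.I * φ t) • app (Ai t) f

/-- The values on `φ f` of the symmetric part of `l`. -/
def symmPart (C : H →ₗ.[ℂ] H) (φ : ℝ → ℂ) (f : H) (t : ℝ) : H := φ t • app C f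

omit [CompleteSpace H] in
theorem continuous_of_isTestFunction (hφ : IsTestFunction φ) {X : Type*} [NormedAddCommGroup X]
    {G : ℝ → X} (hG : ContinuousOn G (Ioo 0 1)) (h0 : ∀ t ∉ tsupport φ, G t = 0) :
    Continuous G ∧ HasCompactSupport G :=
  ⟨continuous_of_continuousOn_of_eq_zero isOpen_Ioo hφ.2.1 hφ.2.2 hG h0,
    HasCompactSupport.intro hφ.2.1 h0⟩

theorem IsTestFunction.deriv_eq_zero (φ : ℝ → ℂ) {t : ℝ} (ht : t ∉ tsupport φ) :
    deriv φ t = 0 := by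
  by_contra h
  exact ht (support_deriv_subset (f := φ) h)

omit [CompleteSpace H] in
theorem skewPart_eq_zero {t : ℝ} (ht : t ∉ tsupport φ) : skewPart α Ai φ f t = 0 := by
  simp [skewPart, image_eq_zero_of_notMem_tsupport ht, IsTestFunction.deriv_eq_zero φ ht]

omit [CompleteSpace H] in
theorem symmPart_eq_zero {t : ℝ} (ht : t ∉ tsupport φ) : symmPart C φ f t = 0 := by
  simp [symmPart, image_eq_zero_of_notMem_tsupport ht]

omit [CompleteSpace H] in
theorem continuous_symmPart (hφ : IsTestFunction φ) : Continuous (symmPart C φ f) :=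
  hφ.1.continuous.smul continuous_const

theorem continuousOn_skewPart (hα : IsRegularWeight α) (hA : StandingAssumptions α D A Ar Ai C)
    (hφ : IsTestFunction φ) (hf : f ∈ D) : ContinuousOn (skewPart α Ai φ f) (Ioo 0 1) := by
  have h1 : ContinuousOn (fun t => ((deriv α t / (2 * α t) : ℝ) : ℂ)) (Ioo 0 1) := by
    refine Complex.continuous_ofReal.comp_continuousOn (hα.continuousOn_deriv.div
      ((hα.continuousOn.mono Ioo_subset_Icc_self).const_mul _) fun t ht => ?_)
    have := hα.pos t ht
    positivity
  have h2 : Continuous (deriv φ) := hφ.1.continuous_deriv (by norm_num)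
  have h3 := ((hA.imag_smooth f hf).continuousOn).mono Ioo_subset_Icc_self
  have h4 : Continuous φ := hφ.1.continuous
  exact ((h2.continuousOn.add (h4.continuousOn.mul h1)).smul continuousOn_const).add
    ((h4.const_mul _).continuousOn.smul h3)

theorem ae_app_real (hA : StandingAssumptions α D A Ar Ai C) (hf : f ∈ D) :
    ∀ᵐ t ∂volume.restrict (Ioo (0 : ℝ) 1),
      app (Ar t) f = ((deriv α t / (2 * α t) : ℝ) : ℂ) • f + app C f := by
  filter_upwards [hA.normality] with t h
  exact app_real h (hA.le_domain_const hf)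

/-- Together with `ae_expressionPlus_eq` this shows that `l` and `l⁺` differ only in the sign of the
skew part, so one integration by parts serves both. -/
theorem ae_expression_eq (hA : StandingAssumptions α D A Ar Ai C) (hf : f ∈ D) :
    ∀ᵐ t ∂weightedMeasure α, deriv φ t • f + φ t • app (A t) f =
      skewPart α Ai φ f t + symmPart C φ f t := by
  refine weightedMeasure_absolutelyContinuous.ae_le ?_
  filter_upwards [ae_app_real hA hf, ae_restrict_mem measurableSet_Ioo] with t h ht
  rw [hA.app_coefficient (Ioo_subset_Icc_self ht) hf, h, skewPart, symmPart]
  module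

theorem ae_expressionPlus_eq (hα : IsRegularWeight α) (hA : StandingAssumptions α D A Ar Ai C)
    (hφ : IsTestFunction φ) (hf : f ∈ D) :
    ∀ᵐ t ∂weightedMeasure α,
      -((deriv (fun s => (α s : ℂ) * φ s) t / (α t : ℂ)) • f) + φ t • app (A t)† f =
      symmPart C φ f t - skewPart α Ai φ f t := by
  refine weightedMeasure_absolutelyContinuous.ae_le ?_
  filter_upwards [ae_app_real hA hf, ae_restrict_mem measurableSet_Ioo] with t h ht
  have h0 : (α t : ℂ) ≠ 0 := by exact_mod_cast (hα.pos t ht).ne'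
  have h1 : HasDerivAt (fun s => (α s : ℂ)) ((deriv α t : ℝ) : ℂ) t :=
    (hα.hasDerivAt t ht).ofReal_comp
  have h2 : HasDerivAt φ (deriv φ t) t :=
    (hφ.1.differentiable (by norm_num) t).hasDerivAt
  have h3 : deriv (fun s => (α s : ℂ) * φ s) t / (α t : ℂ) =
      ((deriv α t : ℝ) : ℂ) / α t * φ t + deriv φ t := by
    have h4 : deriv (fun s => (α s : ℂ) * φ s) t = _ := (h1.mul h2).deriv
    rw [h4]
    field_simp
  rw [hA.app_adjoint_coefficient (Ioo_subset_Icc_self ht) hf, h, skewPart, symmPart, h3]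
  have h4 : ((deriv α t / (2 * α t) : ℝ) : ℂ) = ((deriv α t : ℝ) : ℂ) / α t / 2 := by
    push_cast
    rw [div_div, mul_comm]
  rw [h4]
  module

omit [InnerProductSpace ℂ H] [CompleteSpace H] in
theorem memLp_of_isTestFunction (hα : IsRegularWeight α) (hφ : IsTestFunction φ)
    {G : ℝ → H} (hG : ContinuousOn G (Ioo 0 1)) (h0 : ∀ t ∉ tsupport φ, G t = 0) :
    MemLp G 2 (weightedMeasure α) := by
  have := hα.isFiniteMeasure
  obtain ⟨h1, h2⟩ := continuous_of_isTestFunction hφ hG h0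
  exact h1.memLp_of_hasCompactSupport h2

/-- The graphs contain `φ f` only if its images under `l` and `l⁺` are square integrable. They are,
because the singular coefficient `α'/α` is continuous on the compact support of `φ` inside `(0, 1)`.
-/
theorem exists_mem_graphs (hα : IsRegularWeight α) (hA : StandingAssumptions α D A Ar Ai C)
    (hφ : IsTestFunction φ) (hf : f ∈ D) :
    ∃ v : WeightedL2 H α, (∀ᵐ t ∂weightedMeasure α, v t = φ t • f) ∧
      v ∈ (preMinimalGraph α D A).map (LinearMap.fst ℂ _ _) ∧
      v ∈ (preMinimalPlusGraph α D A).map (LinearMap.fst ℂ _ _) := by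
  have hφc : Continuous φ := hφ.1.continuous
  have h1 : MemLp (fun t => φ t • f) 2 (weightedMeasure α) :=
    memLp_of_isTestFunction hα hφ (hφc.smul continuous_const).continuousOn
      fun t ht => by simp [image_eq_zero_of_notMem_tsupport ht]
  have h2 : MemLp (skewPart α Ai φ f) 2 (weightedMeasure α) :=
    memLp_of_isTestFunction hα hφ (continuousOn_skewPart hα hA hφ hf) fun t => skewPart_eq_zero
  have h3 : MemLp (symmPart C φ f) 2 (weightedMeasure α) :=
    memLp_of_isTestFunction hα hφ (continuous_symmPart hφ).continuousOn fun t => symmPart_eq_zero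
  refine ⟨h1.toLp, h1.coeFn_toLp, ⟨(h1.toLp, (h2.add h3).toLp), Submodule.subset_span ?_, rfl⟩,
    ⟨(h1.toLp, (h3.sub h2).toLp), Submodule.subset_span ?_, rfl⟩⟩
  · refine ⟨φ, f, hφ, hf, h1.coeFn_toLp, ?_⟩
    filter_upwards [(h2.add h3).coeFn_toLp, ae_expression_eq (φ := φ) hA hf] with t h4 h5
    rw [h5]
    exact h4
  · refine ⟨φ, f, hφ, hf, h1.coeFn_toLp, ?_⟩
    filter_upwards [(h3.sub h2).coeFn_toLp, ae_expressionPlus_eq hα hA hφ hf] with t h4 h5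
    rw [h5]
    exact h4

/-- An element of the weighted space which is orthogonal to all `φ f` is zero. -/
theorem eq_zero_of_orthogonal_test {ι : Type*} [Countable ι] (b : HilbertBasis ι ℂ H)
    (hbD : ∀ i, b i ∈ D) (hα : IsRegularWeight α) (hA : StandingAssumptions α D A Ar Ai C)
    {u : WeightedL2 H α}
    (hu : ∀ φ f, IsTestFunction φ → f ∈ D → ∀ v : WeightedL2 H α,
      (∀ᵐ t ∂weightedMeasure α, v t = φ t • f) → ⟪v, u⟫_ℂ = 0) : u = 0 := by
  have := hα.isFiniteMeasure
  -- Fundamental lemma of the calculus of variations, one coordinate at a time.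
  have key : ∀ i, ∀ᵐ t ∂volume, t ∈ Ioo (0 : ℝ) 1 → α t • ⟪b i, u t⟫_ℂ = 0 := by
    intro i
    have hint : Integrable (fun t => ⟪b i, u t⟫_ℂ) (weightedMeasure α) :=
      ((Lp.memLp u).const_inner (b i)).integrable one_le_two
    have hloc := (hα.integrable_iff.1 hint).locallyIntegrableOn
    refine isOpen_Ioo.ae_eq_zero_of_integral_contDiff_smul_eq_zero hloc fun g hg hgc hgs => ?_
    have hφ : IsTestFunction fun t => (g t : ℂ) := by
      have hs : tsupport (fun t => (g t : ℂ)) = tsupport g := by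
        rw [tsupport, tsupport]
        congr 1
        ext t
        simp
      refine ⟨Complex.ofRealCLM.contDiff.comp hg, ?_, ?_⟩
      · rw [HasCompactSupport, hs]; exact hgc
      · rw [hs]; exact hgs
    obtain ⟨v, hv, -⟩ := exists_mem_graphs hα hA hφ (hbD i)
    have h1 := hu _ _ hφ (hbD i) v hv
    rw [L2.inner_def] at h1
    have h2 : ∫ t, ⟪v t, u t⟫_ℂ ∂weightedMeasure α =
        ∫ t, g t • ⟪b i, u t⟫_ℂ ∂weightedMeasure α := by
      refine integral_congr_ae ?_
      filter_upwards [hv] with t ht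
      rw [ht, inner_smul_left, Complex.conj_ofReal, Complex.real_smul]
    rw [h2, hα.integral_eq] at h1
    rw [← h1, ← setIntegral_eq_integral_of_forall_compl_eq_zero (s := Ioo (0 : ℝ) 1)]
    · refine setIntegral_congr_fun measurableSet_Ioo fun t _ => ?_
      exact smul_comm _ _ _
    · intro t ht
      have : g t = 0 := image_eq_zero_of_notMem_tsupport fun h => ht (hgs h)
      rw [this, zero_smul]
  have h0 : ∀ᵐ t ∂volume.restrict (Ioo (0 : ℝ) 1), u t = 0 := by
    rw [ae_restrict_iff' measurableSet_Ioo]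
    filter_upwards [ae_all_iff.2 key] with t h ht
    refine HilbertBasis.eq_zero_of_inner_eq_zero b fun i => ?_
    exact (smul_eq_zero.1 (h i ht)).resolve_left (hα.pos t ht).ne'
  exact (Lp.eq_zero_iff_ae_eq_zero).2 (weightedMeasure_absolutelyContinuous.ae_le h0)

theorem dense_domains {ι : Type*} [Countable ι] (b : HilbertBasis ι ℂ H)
    (hbD : ∀ i, b i ∈ D) (hα : IsRegularWeight α) (hA : StandingAssumptions α D A Ar Ai C) :
    Dense ((preMinimalGraph α D A).map (LinearMap.fst ℂ _ _) : Set (WeightedL2 H α)) ∧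
      Dense ((preMinimalPlusGraph α D A).map (LinearMap.fst ℂ _ _) : Set (WeightedL2 H α)) := by
  have aux : ∀ M : Submodule ℂ (WeightedL2 H α),
      (∀ φ f, IsTestFunction φ → f ∈ D → ∀ v : WeightedL2 H α,
        (∀ᵐ t ∂weightedMeasure α, v t = φ t • f) → v ∈ M) → Dense (M : Set (WeightedL2 H α)) := by
    intro M hM
    rw [Submodule.dense_iff_topologicalClosure_eq_top, ← Submodule.orthogonal_eq_bot_iff,
      Submodule.orthogonal_closure, Submodule.eq_bot_iff]
    intro u hu
    exact eq_zero_of_orthogonal_test b hbD hα hA fun φ f hφ hf v hv =>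
      (Submodule.mem_orthogonal M u).1 hu v (hM φ f hφ hf v hv)
  refine ⟨aux _ fun φ f hφ hf v hv => ?_, aux _ fun φ f hφ hf v hv => ?_⟩ <;>
  · obtain ⟨v', h1, h2, h3⟩ := exists_mem_graphs hα hA hφ hf
    have : v = v' := by
      refine Lp.ext ?_
      filter_upwards [hv, h1] with t h4 h5
      rw [h4, h5]
    rw [this]
    assumption

/-- Integration by parts against an eigenfunction. -/
theorem integral_skewPart (hα : IsRegularWeight α) (hA : StandingAssumptions α D A Ar Ai C)
    {lam : ℝ} {η : ℂ} {w : ℝ → H} (hw : IsMode D Ai C lam η w)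
    (hφ : IsTestFunction φ) (hf : f ∈ D) :
    IntegrableOn (fun t => √(α t) • ⟪w t, skewPart α Ai φ f t⟫_ℂ) (Ioo 0 1) ∧
    IntegrableOn (fun t => √(α t) • ⟪w t, φ t • f⟫_ℂ) (Ioo 0 1) ∧
    ∫ t in Ioo (0 : ℝ) 1, √(α t) • ⟪w t, skewPart α Ai φ f t⟫_ℂ =
      -(starRingEnd ℂ) η * ∫ t in Ioo (0 : ℝ) 1, √(α t) • ⟪w t, φ t • f⟫_ℂ := by
  have hsq : ContinuousOn (fun t => √(α t)) (Ioo 0 1) :=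
    (hα.continuousOn.mono Ioo_subset_Icc_self).sqrt
  have hwc := hw.continuousOn.mono Ioo_subset_Icc_self
  have hφc : Continuous φ := hφ.1.continuous
  have hintegrable : ∀ {G : ℝ → H}, ContinuousOn G (Ioo 0 1) → (∀ t ∉ tsupport φ, G t = 0) →
      Continuous (fun t => √(α t) • ⟪w t, G t⟫_ℂ) ∧
        Integrable (fun t => √(α t) • ⟪w t, G t⟫_ℂ) := by
    intro G hG h0
    have hc : ContinuousOn (fun t => √(α t) • ⟪w t, G t⟫_ℂ) (Ioo 0 1) :=
      hsq.smul (hwc.inner (𝕜 := ℂ) hG)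
    obtain ⟨h1, h2⟩ := continuous_of_isTestFunction hφ hc fun t ht => by simp [h0 t ht]
    exact ⟨h1, h1.integrable_of_hasCompactSupport h2⟩
  have hzero : ∀ {G : ℝ → H}, (∀ t ∉ tsupport φ, G t = 0) →
      ∫ t in Ioo (0 : ℝ) 1, √(α t) • ⟪w t, G t⟫_ℂ = ∫ t, √(α t) • ⟪w t, G t⟫_ℂ := by
    intro G h0
    refine setIntegral_eq_integral_of_forall_compl_eq_zero fun t ht => ?_
    rw [h0 t fun h => ht (hφ.2.2 h), inner_zero_right, smul_zero]
  have hJ0 : ∀ t ∉ tsupport φ, skewPart α Ai φ f t = 0 := fun t => skewPart_eq_zero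
  have hF0 : ∀ t ∉ tsupport φ, φ t • f = 0 := fun t ht => by
    rw [image_eq_zero_of_notMem_tsupport ht, zero_smul]
  have hJ := hintegrable (continuousOn_skewPart hα hA hφ hf) hJ0
  have hF := hintegrable (G := fun t => φ t • f) (hφc.smul continuous_const).continuousOn hF0
  refine ⟨hJ.2.integrableOn, hF.2.integrableOn, ?_⟩
  rw [hzero hJ0, hzero hF0]
  -- The derivative of `√α` supplies the term `α'/(2α)`, and self-adjointness moves `A_i(t)` from
  -- `w` onto `f`. Off the support of `φ` everything vanishes, so the total integral of this
  -- derivative is zero.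
  have hder : ∀ t, HasDerivAt (fun t => √(α t) • ⟪w t, φ t • f⟫_ℂ)
      (√(α t) • ⟪w t, skewPart α Ai φ f t⟫_ℂ +
        (starRingEnd ℂ) η * √(α t) • ⟪w t, φ t • f⟫_ℂ) t := by
    intro t
    by_cases ht : t ∈ tsupport φ
    · have ht' := hφ.2.2 ht
      have htc := Ioo_subset_Icc_self ht'
      have hp := hα.pos t ht'
      have h1 : HasDerivAt (fun t => √(α t)) (deriv α t / (2 * √(α t))) t :=
        (hα.hasDerivAt t ht').sqrt hp.ne'
      have h2 : HasDerivAt w (η • w t - Complex.I • app (Ai t) (w t)) t :=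
        (hw.hasDeriv t htc).hasDerivAt (Icc_mem_nhds ht'.1 ht'.2)
      have h3 : HasDerivAt φ (deriv φ t) t :=
        (hφ.1.differentiable (by norm_num) t).hasDerivAt
      have h4 := h1.smul (h2.inner ℂ (h3.smul_const f))
      refine h4.congr_deriv ?_
      have h5 := inner_app_eq_of_isSelfAdjoint (hA.imag_selfAdjoint t htc)
        ((hA.mem_iff htc).1 (hw.mem t htc)).2 ((hA.mem_iff htc).1 hf).2
      have h6 : (((deriv α t / (2 * √(α t)) : ℝ)) : ℂ) =
          ((√(α t) : ℝ) : ℂ) * ((deriv α t / (2 * α t) : ℝ) : ℂ) := by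
        rw [← Complex.ofReal_mul]
        congr 1
        have hs := Real.sqrt_pos.2 hp
        field_simp
        rw [Real.sq_sqrt hp.le]
      simp only [skewPart, inner_add_right, inner_sub_left, inner_smul_left, inner_smul_right,
        Complex.conj_I, Complex.real_smul, h5, h6]
      ring
    · have h1 : (fun _ => (0 : ℂ)) =ᶠ[𝓝 t] fun t => √(α t) • ⟪w t, φ t • f⟫_ℂ := by
        filter_upwards [(isClosed_tsupport φ).isOpen_compl.mem_nhds ht] with s hs
        rw [hF0 s hs, inner_zero_right, smul_zero]
      rw [hJ0 t ht, hF0 t ht, inner_zero_right, smul_zero, mul_zero, add_zero]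
      exact (hasDerivAt_const t (0 : ℂ)).congr_of_eventuallyEq h1.symm
  have hz := integral_eq_zero_of_hasDerivAt_of_integrable hder
    (hJ.2.add (hF.2.const_mul _)) hF.2
  rw [integral_add hJ.2 (hF.2.const_mul _), integral_const_mul] at hz
  rw [neg_mul]
  exact eq_neg_of_add_eq_zero_left hz

/-- The two expressions against an eigenfunction. -/
theorem inner_expressions (hα : IsRegularWeight α) (hA : StandingAssumptions α D A Ar Ai C)
    {lam : ℝ} {η : ℂ} {w : ℝ → H} (hw : IsMode D Ai C lam η w)
    (hφ : IsTestFunction φ) (hf : f ∈ D) {u v : WeightedL2 H α}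
    (hu : u =ᵐ[weightedMeasure α] unweight α w) (hv : ∀ᵐ t ∂weightedMeasure α, v t = φ t • f) :
    (∀ g : WeightedL2 H α, (∀ᵐ t ∂weightedMeasure α, g t =
        -((deriv (fun s => (α s : ℂ) * φ s) t / (α t : ℂ)) • f) + φ t • app (A t)† f) →
      ⟪((lam : ℂ) + η) • u, v⟫_ℂ = ⟪u, g⟫_ℂ) ∧
    (∀ g : WeightedL2 H α, (∀ᵐ t ∂weightedMeasure α, g t =
        deriv φ t • f + φ t • app (A t) f) →
      ⟪((lam : ℂ) - η) • u, v⟫_ℂ = ⟪u, g⟫_ℂ) := by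
  obtain ⟨h1, h2, h3⟩ := integral_skewPart hα hA hw hφ hf
  have hsymm : ∀ t ∈ Ioo (0 : ℝ) 1, √(α t) • ⟪w t, symmPart C φ f t⟫_ℂ =
      (lam : ℂ) * √(α t) • ⟪w t, φ t • f⟫_ℂ := by
    intro t ht
    have htc := Ioo_subset_Icc_self ht
    rw [symmPart, inner_smul_right, ← inner_app_eq_of_isSelfAdjoint hA.const_selfAdjoint
      (hA.le_domain_const (hw.mem t htc)) (hA.le_domain_const hf), hw.app_const t htc,
      inner_smul_left, inner_smul_right, Complex.conj_ofReal, Complex.real_smul, Complex.real_smul]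
    ring
  have h4 : IntegrableOn (fun t => √(α t) • ⟪w t, symmPart C φ f t⟫_ℂ) (Ioo 0 1) :=
    (integrableOn_congr_fun hsymm measurableSet_Ioo).2 (h2.const_mul _)
  have h5 : ∫ t in Ioo (0 : ℝ) 1, √(α t) • ⟪w t, symmPart C φ f t⟫_ℂ =
      (lam : ℂ) * ∫ t in Ioo (0 : ℝ) 1, √(α t) • ⟪w t, φ t • f⟫_ℂ := by
    rw [setIntegral_congr_fun measurableSet_Ioo hsymm, integral_const_mul]
  constructor
  · intro g hg
    have hg' : g =ᵐ[weightedMeasure α] fun t => symmPart C φ f t - skewPart α Ai φ f t := by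
      filter_upwards [hg, ae_expressionPlus_eq hα hA hφ hf] with t h6 h7
      rw [h6, h7]
    rw [inner_smul_left, inner_unweight hα hu hv, inner_unweight hα hu hg']
    simp only [inner_sub_right, smul_sub]
    rw [integral_sub h4 h1, h5, h3, map_add, Complex.conj_ofReal]
    ring
  · intro g hg
    have hg' : g =ᵐ[weightedMeasure α] fun t => skewPart α Ai φ f t + symmPart C φ f t := by
      filter_upwards [hg, ae_expression_eq (φ := φ) hA hf] with t h6 h7
      rw [h6, h7]
    rw [inner_smul_left, inner_unweight hα hu hv, inner_unweight hα hu hg']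
    simp only [inner_add_right, smul_add]
    rw [integral_add h1 h4, h5, h3, map_sub, Complex.conj_ofReal]
    ring

variable {K W : H →L[ℂ] H} {ι : Type*} {b : HilbertBasis ι ℂ H} {lam : ι → ℝ} {ζ : ι → ℂ}
  {U : ℝ → ℝ → H →L[ℂ] H}

/-- The functions `modeLp` are eigenvectors of the boundary value problem. -/
theorem boundaryOp_modeLp (hα : IsRegularWeight α) (hA : StandingAssumptions α D A Ar Ai C)
    (hK : IsResolventAt C 0 K) (hc : IsCompactOperator K) (hb : IsEigenbasis K W b lam ζ)
    (hU : IsEvolutionFamily D Ai U) (hζ : ∀ i, ‖ζ i‖ = 1) (p : ι × ℤ) :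
    ∃ h : modeLp hα (isMode_mode hA hK hc hb hU p).continuousOn ∈
        (boundaryOp α D A (U 1 0 * W)).domain,
      boundaryOp α D A (U 1 0 * W) ⟨_, h⟩ =
        ((lam p.1 : ℂ) + Complex.I * frequency ζ p) •
          modeLp hα (isMode_mode hA hK hc hb hU p).continuousOn := by
  have := hb.countable
  have hbD := hb.mem_domain hA hK hc
  obtain ⟨hd, hd'⟩ := dense_domains b hbD hα hA
  have hexpr := fun q φ f (hφ : IsTestFunction φ) (hf : f ∈ D) (v : WeightedL2 H α) hv =>
    inner_expressions hα hA (isMode_mode hA hK hc hb hU q) hφ hf (v := v)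
      (coeFn_modeLp hα (isMode_mode hA hK hc hb hU q).continuousOn) hv
  have hgen : ∀ q, ∀ x ∈ {x : WeightedL2 H α × WeightedL2 H α | ∃ (φ : ℝ → ℂ) (f : H),
      IsTestFunction φ ∧ f ∈ D ∧ (∀ᵐ t ∂weightedMeasure α, x.1 t = φ t • f) ∧
      (∀ᵐ t ∂weightedMeasure α, x.2 t = deriv φ t • f + φ t • app (A t) f)},
      ⟪((lam q.1 : ℂ) - Complex.I * frequency ζ q) •
        modeLp hα (isMode_mode hA hK hc hb hU q).continuousOn, x.1⟫_ℂ =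
        ⟪modeLp hα (isMode_mode hA hK hc hb hU q).continuousOn, x.2⟫_ℂ := by
    rintro q x ⟨φ, f, hφ, hf, h1, h2⟩
    exact (hexpr q φ f hφ hf x.1 h1).2 x.2 h2
  have hgen' : ∀ q, ∀ x ∈ {x : WeightedL2 H α × WeightedL2 H α | ∃ (φ : ℝ → ℂ) (f : H),
      IsTestFunction φ ∧ f ∈ D ∧ (∀ᵐ t ∂weightedMeasure α, x.1 t = φ t • f) ∧
      (∀ᵐ t ∂weightedMeasure α, x.2 t =
        -((deriv (fun s => (α s : ℂ) * φ s) t / (α t : ℂ)) • f) + φ t • app (A t)† f)},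
      ⟪((lam q.1 : ℂ) + Complex.I * frequency ζ q) •
        modeLp hα (isMode_mode hA hK hc hb hU q).continuousOn, x.1⟫_ℂ =
        ⟪modeLp hα (isMode_mode hA hK hc hb hU q).continuousOn, x.2⟫_ℂ := by
    rintro q x ⟨φ, f, hφ, hf, h1, h2⟩
    exact (hexpr q φ f hφ hf x.1 h1).1 x.2 h2
  -- The span is the graph of an operator only if it is single-valued: when `x.1 = 0`, the adjoint
  -- identity makes `x.2` orthogonal to every mode, and the modes are total.
  have hsingle : ∀ {S : Set (WeightedL2 H α × WeightedL2 H α)} {ν : ι × ℤ → ℂ},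
      (∀ q, ∀ x ∈ S, ⟪ν q • modeLp hα (isMode_mode hA hK hc hb hU q).continuousOn, x.1⟫_ℂ =
        ⟪modeLp hα (isMode_mode hA hK hc hb hU q).continuousOn, x.2⟫_ℂ) →
      ∀ x ∈ Submodule.span ℂ S, x.1 = 0 → x.2 = 0 := by
    intro S ν hS x hx hx0
    refine modeLp_total hα hA hK hc hb hU fun q => ?_
    have h1 : ⟪ν q • modeLp hα (isMode_mode hA hK hc hb hU q).continuousOn, x.1⟫_ℂ =
        ⟪modeLp hα (isMode_mode hA hK hc hb hU q).continuousOn, x.2⟫_ℂ := by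
      clear hx0
      induction hx using Submodule.span_induction with
      | mem p hp => exact hS q p hp
      | zero => simp
      | add p q _ _ h1 h2 =>
        rw [Prod.fst_add, Prod.snd_add, inner_add_right, inner_add_right, h1, h2]
      | smul c p _ h1 => rw [Prod.smul_fst, Prod.smul_snd, inner_smul_right, inner_smul_right, h1]
    rw [← h1, hx0, inner_zero_right]
  -- Testing against `L₀⁺` gives membership in `D(L)` and the eigenvalue `λ + iθ`; testing against
  -- `L₀` gives membership in `D(L⁺)`.
  obtain ⟨hm, hv⟩ := adjoint_closure_span_apply hd' (hsingle hgen') (hgen' p)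
  obtain ⟨hm', -⟩ := adjoint_closure_span_apply hd (hsingle hgen) (hgen p)
  have hbc : modeLp hα (isMode_mode hA hK hc hb hU p).continuousOn ∈
      boundaryCondition α (U 1 0 * W) := by
    have hcont := (isMode_mode hA hK hc hb hU p).continuousOn
    have h0 : (0 : ℝ) ∈ Icc (0 : ℝ) 1 := ⟨le_rfl, zero_le_one⟩
    have h1 : (1 : ℝ) ∈ Icc (0 : ℝ) 1 := ⟨zero_le_one, le_rfl⟩
    refine ⟨mode U b ζ p 0, mode U b ζ p 1, ⟨mode U b ζ p, ?_, ?_, ?_⟩, ?_⟩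
    · filter_upwards [coeFn_modeLp hα hcont, weightedMeasure_absolutelyContinuous.ae_le
        (ae_restrict_mem measurableSet_Ioo)] with t h2 ht
      rw [h2, sqrt_smul_unweight hα _ ht]
    · exact (hcont 0 h0).mono_left (nhdsWithin_le_iff.2 (Icc_mem_nhdsGT zero_lt_one))
    · exact (hcont 1 h1).mono_left (nhdsWithin_le_iff.2 (Icc_mem_nhdsLT zero_lt_one))
    -- With `exp(iθ) = ζ`, the value at `1` is `ζ U(1,0) (b i) = U(1,0) W (b i)`.
    · have h2 : Complex.exp (Complex.I * frequency ζ p) = ζ p.1 := by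
        have h3 := Complex.norm_mul_exp_arg_mul_I (ζ p.1)
        rw [hζ, Complex.ofReal_one, one_mul] at h3
        have h4 : Complex.I * frequency ζ p =
            (ζ p.1).arg * Complex.I + (p.2 : ℂ) * (2 * Real.pi * Complex.I) := by
          rw [frequency]; push_cast; ring
        rw [h4, Complex.exp_add, Complex.exp_int_mul_two_pi_mul_I, mul_one, h3]
      change mode U b ζ p 1 = U 1 0 (W (mode U b ζ p 0))
      rw [mode, mode, hU.initial 0 h0 _ (hbD p.1), Complex.ofReal_one, Complex.ofReal_zero,
        mul_one, mul_zero, Complex.exp_zero, one_smul, hb.unitary_apply, map_smul, h2]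
  refine ⟨⟨⟨hm', hbc⟩, hm⟩, ?_⟩
  rw [← hv]
  exact LinearPMap.domRestrict_apply rfl

omit [NormedAddCommGroup H] [InnerProductSpace ℂ H] [CompleteSpace H] in
-- Lines with `λ > Re z + 1` are at distance at least `1`. Only finitely many others remain, and on
-- each the points are 2π-spaced, so the one nearest to `z` is found by rounding.
theorem exists_dist_eigenvalue_pos (hfin : ∀ x, {i | lam i ≤ x}.Finite) {z : ℂ}
    (hz : z ∉ range fun p : ι × ℤ => (lam p.1 : ℂ) + Complex.I * frequency ζ p) :
    ∃ c > 0, ∀ p : ι × ℤ, c ≤ ‖(lam p.1 : ℂ) + Complex.I * frequency ζ p - z‖ := by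
  have hre : ∀ p : ι × ℤ, ((lam p.1 : ℂ) + Complex.I * frequency ζ p - z).re = lam p.1 - z.re :=
    fun p => by simp
  have him : ∀ p : ι × ℤ, ((lam p.1 : ℂ) + Complex.I * frequency ζ p - z).im =
    frequency ζ p - z.im := fun p => by simp
  have hsingle : ∀ i, ∃ c > 0, ∀ k : ℤ,
      c ≤ ‖(lam i : ℂ) + Complex.I * frequency ζ (i, k) - z‖ := by
    intro i
    by_cases hi : lam i = z.re
    · set x := (z.im - (ζ i).arg) / (2 * Real.pi) with hx
      have hpi : 0 < 2 * Real.pi := Real.two_pi_pos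
      have hfreq : ∀ k : ℤ, frequency ζ (i, k) - z.im = -(2 * Real.pi * (x - k)) := fun k => by
        rw [frequency, hx]
        field_simp
        ring
      have hxr : x - round x ≠ 0 := fun h0 => hz ⟨(i, round x), by
        rw [← sub_eq_zero]
        refine Complex.ext ?_ ?_
        · rw [hre]; simp [hi]
        · rw [him, hfreq, h0]; simp⟩
      refine ⟨2 * Real.pi * |x - round x|, mul_pos hpi (abs_pos.2 hxr), fun k => ?_⟩
      refine le_trans ?_ (Complex.abs_im_le_norm _)
      rw [him (i, k), hfreq, abs_neg, abs_mul, abs_of_pos hpi]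
      exact mul_le_mul_of_nonneg_left (round_le x k) hpi.le
    · refine ⟨|lam i - z.re|, abs_pos.2 (sub_ne_zero.2 hi), fun k => ?_⟩
      rw [← hre (i, k)]
      exact Complex.abs_re_le_norm _
  choose c hc0 hc using hsingle
  have hev : ∀ᶠ r in 𝓝[>] (0 : ℝ), r ≤ 1 ∧ ∀ i ∈ {i | lam i ≤ z.re + 1}, r ≤ c i := by
    refine Eventually.and ?_ ((eventually_all_finite (hfin _)).2 fun i _ => ?_)
    · exact eventually_nhdsWithin_of_eventually_nhds (eventually_le_nhds one_pos)
    · exact eventually_nhdsWithin_of_eventually_nhds (eventually_le_nhds (hc0 i))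
  obtain ⟨r, ⟨hr1, hr⟩, hr0⟩ := (hev.and self_mem_nhdsWithin).exists
  refine ⟨r, hr0, fun p => ?_⟩
  by_cases hp : lam p.1 ≤ z.re + 1
  · exact (hr _ hp).trans (hc p.1 p.2)
  · refine hr1.trans (le_trans ?_ (Complex.abs_re_le_norm _))
    rw [hre]
    exact le_trans (by linarith) (le_abs_self _)

/-- The spectrum of the boundary value problem. -/
theorem pmapSpectrum_boundaryOp (hα : IsRegularWeight α)
    (hA : StandingAssumptions α D A Ar Ai C)
    (hK : IsResolventAt C 0 K) (hc : IsCompactOperator K) (hb : IsEigenbasis K W b lam ζ)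
    (hU : IsEvolutionFamily D Ai U) (hζ : ∀ i, ‖ζ i‖ = 1)
    (hN : IsNormal (boundaryOp α D A (U 1 0 * W))) :
    pmapSpectrum (boundaryOp α D A (U 1 0 * W)) =
      range fun p : ι × ℤ => (lam p.1 : ℂ) + Complex.I * frequency ζ p := by
  have hon := orthonormal_modeLp hα hA hK hc hb hU
  have htot : (Submodule.span ℂ (range fun p =>
      modeLp hα (isMode_mode hA hK hc hb hU p).continuousOn))ᗮ = ⊥ := by
    rw [Submodule.eq_bot_iff]
    intro u hu
    refine modeLp_total hα hA hK hc hb hU fun p => ?_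
    exact (Submodule.mem_orthogonal _ u).1 hu _ (Submodule.subset_span ⟨p, rfl⟩)
  have heig := boundaryOp_modeLp hα hA hK hc hb hU hζ
  refine Subset.antisymm (fun z hz => ?_) ?_
  · by_contra hnot
    obtain ⟨c, hc0, hcb⟩ : ∃ c > 0, ∀ p : ι × ℤ,
        c ≤ ‖(lam p.1 : ℂ) + Complex.I * frequency ζ p - z‖ :=
      exists_dist_eigenvalue_pos hb.finite hnot
    refine hN.not_mem_pmapSpectrum (HilbertBasis.mkOfOrthogonalEqBot hon htot)
      (fun p => (lam p.1 : ℂ) + Complex.I * frequency ζ p) (fun p => ?_) hc0 hcb hz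
    rw [HilbertBasis.coe_mkOfOrthogonalEqBot]
    exact heig p
  · rintro z ⟨p, rfl⟩
    obtain ⟨h1, h2⟩ := heig p
    exact mem_pmapSpectrum_of_eigenvector h1 (hon.ne_zero p) h2

end Eigenfunctions

/-! ### Rearrangements and sorted enumerations -/

section Counting

/-- Of two monotone families that are rearrangements of each other, the first bounds the second. -/
theorem le_of_monotoneOn_of_comp_equiv {I : Set ℕ} {f g : ℕ → ℝ} (hf : MonotoneOn f I)
    (hg : MonotoneOn g I) (τ : I ≃ I) (h : ∀ n : I, g (τ n) = f n) {n : ℕ} (hn : n ∈ I) :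
    g n ≤ f n := by
  by_contra! hlt
  -- If `f n < g n`, then for `m ≤ n` we have `g (τ m) = f m ≤ f n < g n`, so `τ m < n`. This would
  -- inject `{m ≤ n}` into the strictly smaller `{m < n}`.
  have hmaps : ∀ m ∈ {m : I | (m : ℕ) ≤ n}, τ m ∈ {m : I | (m : ℕ) < n} := by
    intro m hm
    have h1 : g (τ m) < g n := by
      rw [h]
      exact (hf m.2 hn hm).trans_lt hlt
    by_contra! hle
    exact absurd (hg hn (τ m).2 (not_lt.1 hle)) (not_le.2 h1)
  have hfin : {m : I | (m : ℕ) < n}.Finite :=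
    (Set.finite_lt_nat n).preimage Subtype.val_injective.injOn
  have h1 := Set.ncard_le_ncard_of_injOn τ hmaps τ.injective.injOn hfin
  have hss : {m : I | (m : ℕ) < n} ⊂ {m : I | (m : ℕ) ≤ n} := by
    refine ⟨fun m (hm : (m : ℕ) < n) => hm.le, fun hsub => ?_⟩
    have : (⟨n, hn⟩ : I) ∈ {m : I | (m : ℕ) < n} := hsub (le_refl n)
    exact lt_irrefl n this
  have h2 := Set.ncard_lt_ncard hss
    ((Set.finite_le_nat n).preimage Subtype.val_injective.injOn)
  omega

/-- Bijections between corresponding fibres are glued together. Finiteness matters because `encard`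
does not distinguish infinite cardinalities. -/
theorem exists_equiv_of_encard_fiber_eq {ι X : Type*} {I : Set ℕ} {f : ℕ → X} {g : ι → X}
    (hfin : ∀ x, {i | g i = x}.Finite)
    (h : ∀ x, {n | n ∈ I ∧ f n = x}.encard = {i | g i = x}.encard) :
    ∃ e : I ≃ ι, ∀ n : I, g (e n) = f n := by
  have hfib : ∀ x, Nonempty ({n : I // f n = x} ≃ {i // g i = x}) := by
    intro x
    have h1 : ({n | n ∈ I ∧ f n = x}).Finite := by
      rw [← Set.encard_lt_top_iff, h, Set.encard_lt_top_iff]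
      exact hfin x
    let e : {n : I // f n = x} ≃ {n | n ∈ I ∧ f n = x} :=
      Equiv.subtypeSubtypeEquivSubtypeInter (· ∈ I) (fun n => f n = x)
    have := h1.to_subtype
    have := (hfin x).to_subtype
    have h2 : Nat.card {n | n ∈ I ∧ f n = x} = Nat.card {i | g i = x} := by
      rw [Nat.card_coe_set_eq, Nat.card_coe_set_eq, Set.ncard, Set.ncard, h]
    exact ⟨e.trans (Finite.card_eq.1 h2).some⟩
  refine ⟨(Equiv.sigmaFiberEquiv fun n : I => f n).symm.trans
    ((Equiv.sigmaCongrRight fun x => (hfib x).some).trans (Equiv.sigmaFiberEquiv g)), fun n => ?_⟩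
  exact ((hfib (f n)).some ⟨n, rfl⟩).2

/-- The elements of a countable type, listed in the order of the values of a function with finite
sublevel sets. -/
theorem exists_rank {ι : Type*} [Countable ι] {f : ι → ℝ} (hf : ∀ x, {i | f i ≤ x}.Finite) :
    ∃ r : ι → ℕ, Function.Injective r ∧ range r = {n : ℕ | (n : ℕ∞) < ENat.card ι} ∧
      ∀ i j, r i ≤ r j → f i ≤ f j := by
  obtain ⟨enc, henc⟩ := exists_injective_nat ι
  -- Ties of `f` are broken by an injection into `ℕ`; this gives a strict total order with finite
  -- initial segments, and the rank counts predecessors.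
  set lt : ι → ι → Prop := fun j i => f j < f i ∨ f j = f i ∧ enc j < enc i with hlt
  have htrans : ∀ i j k, lt i j → lt j k → lt i k := by
    rintro i j k (h1 | ⟨h1, h1'⟩) (h2 | ⟨h2, h2'⟩)
    · exact Or.inl (h1.trans h2)
    · exact Or.inl (h2 ▸ h1)
    · exact Or.inl (h1 ▸ h2)
    · exact Or.inr ⟨h1.trans h2, h1'.trans h2'⟩
  have hirr : ∀ i, ¬ lt i i := by
    rintro i (h | ⟨-, h⟩)
    · exact lt_irrefl _ h
    · exact lt_irrefl _ h
  have htot : ∀ i j, i ≠ j → lt i j ∨ lt j i := by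
    intro i j hij
    rcases lt_trichotomy (f i) (f j) with h | h | h
    · exact Or.inl (Or.inl h)
    · rcases lt_or_gt_of_ne (henc.ne hij) with h' | h'
      · exact Or.inl (Or.inr ⟨h, h'⟩)
      · exact Or.inr (Or.inr ⟨h.symm, h'⟩)
    · exact Or.inr (Or.inl h)
  have hfin : ∀ i, {j | lt j i}.Finite := fun i => (hf (f i)).subset fun j hj => by
    rcases hj with h | ⟨h, -⟩
    · exact h.le
    · exact h.le
  set r : ι → ℕ := fun i => {j | lt j i}.ncard with hr
  have hmono : ∀ i j, lt i j → r i < r j := fun i j hij =>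
    Set.ncard_lt_ncard ⟨fun k hk => htrans k i j hk hij, fun hsub => hirr i (hsub hij)⟩ (hfin j)
  have hinj : Function.Injective r := by
    intro i j hij
    by_contra hne
    rcases htot i j hne with h | h
    · exact (hmono _ _ h).ne hij
    · exact (hmono _ _ h).ne' hij
  -- The ranks have no gaps: the `r i` predecessors of `i` have distinct ranks below `r i`, so they
  -- exhaust them.
  have hlower : ∀ i n, n < r i → n ∈ range r := by
    intro i n hn
    have himg : r '' {j | lt j i} ⊆ Iio (r i) := by
      rintro _ ⟨j, hj, rfl⟩
      exact hmono j i hj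
    have hcard : (Iio (r i)).ncard ≤ (r '' {j | lt j i}).ncard := by
      rw [Set.ncard_image_of_injective _ hinj, Set.ncard_eq_toFinset_card']
      simp [hr]
    have := Set.eq_of_subset_of_ncard_le himg hcard (Set.finite_Iio _)
    have hn' : n ∈ r '' {j | lt j i} := this ▸ hn
    exact image_subset_range _ _ hn'
  refine ⟨r, hinj, ?_, fun i j hij => ?_⟩
  · ext n
    constructor
    · rintro ⟨i, rfl⟩
      have h1 : (insert i {j | lt j i}).encard = (r i : ℕ∞) + 1 := by
        rw [Set.encard_insert_of_notMem (s := {j | lt j i}) (hirr i), (hfin i).cast_ncard_eq]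
      have h2 : (insert i {j | lt j i}).encard ≤ ENat.card ι := by
        rw [← Set.encard_univ]
        exact Set.encard_le_encard (subset_univ _)
      rw [h1] at h2
      exact (ENat.add_one_le_iff (ENat.natCast_ne_top _)).1 h2
    · intro (hn : (n : ℕ∞) < ENat.card ι)
      by_contra hnot
      have hsub : range r ⊆ Iio n := by
        rintro _ ⟨i, rfl⟩
        change r i < n
        by_contra hge
        rcases (not_lt.1 hge).lt_or_eq with h | h
        · exact hnot (hlower i n h)
        · exact hnot ⟨i, h.symm⟩
      have h1 := Set.encard_le_encard hsub
      rw [← Set.image_univ, hinj.encard_image, Set.encard_univ] at h1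
      have h2 : (Iio n).encard = n := by
        rw [← (Set.finite_Iio n).cast_ncard_eq, Set.ncard_eq_toFinset_card']
        simp
      rw [h2] at h1
      exact absurd hn (not_lt.2 h1)
  · by_contra! h
    exact absurd (hmono j i (Or.inl h)) (not_lt.2 hij)

end Counting

/-! ### Multiplicities of the eigenvalues of `C` and `W* exp(-C)` -/

section Multiplicities

variable {H : Type*} [NormedAddCommGroup H] [InnerProductSpace ℂ H] {ι : Type*}

/-- The expansion of a vector of `S` has only finitely many terms, so `S` is the algebraic span of
the `b i` with `i ∈ J`. -/
theorem toENat_rank_eq_encard (b : HilbertBasis ι ℂ H) {J : Set ι} (hJ : J.Finite)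
    {S : Submodule ℂ H} (h1 : ∀ i ∈ J, b i ∈ S) (h2 : ∀ x ∈ S, ∀ i ∉ J, ⟪b i, x⟫_ℂ = 0) :
    Cardinal.toENat (Module.rank ℂ S) = J.encard := by
  have hS : S = Submodule.span ℂ (b '' J) := by
    refine le_antisymm (fun x hx => ?_) (Submodule.span_le.2 ?_)
    · have h3 := HilbertBasis.hasSum_inner_smul b x
      have h4 : HasSum (fun i => ⟪b i, x⟫_ℂ • b i) (∑ i ∈ hJ.toFinset, ⟪b i, x⟫_ℂ • b i) :=
        hasSum_sum_of_ne_finset_zero fun i hi => by rw [h2 x hx i (by simpa using hi), zero_smul]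
      rw [h3.unique h4]
      exact Submodule.sum_mem _ fun i hi => Submodule.smul_mem _ _
        (Submodule.subset_span ⟨i, by simpa using hi, rfl⟩)
    · rintro _ ⟨i, hi, rfl⟩
      exact h1 i hi
  have hli : LinearIndepOn ℂ id (b '' J) :=
    b.orthonormal.linearIndependent.linearIndepOn_id.mono (image_subset_range _ _)
  rw [hS, rank_span_set hli, ← b.orthonormal.linearIndependent.injective.encard_image J]
  rfl

/-- An infinite Hilbert basis need not span algebraically, but its independence forces the rank to
be at least `ℵ₀`, which is all that the index set sees. -/
theorem eigenIndex_eq (b : HilbertBasis ι ℂ H) :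
    eigenIndex H = {n : ℕ | (n : ℕ∞) < ENat.card ι} := by
  ext n
  change (n : Cardinal) < Module.rank ℂ H ↔ (n : ℕ∞) < ENat.card ι
  rcases finite_or_infinite ι with hfin | hinf
  · have h1 := toENat_rank_eq_encard b (J := univ) finite_univ (S := ⊤) (fun i _ => trivial)
      (fun x _ i hi => absurd (mem_univ i) hi)
    rw [rank_top, Set.encard_univ] at h1
    rw [← h1, Cardinal.natCast_lt_toENat]
  · rw [ENat.card_eq_top_of_infinite]
    have h1 := b.orthonormal.linearIndependent.cardinal_lift_le_rank
    have h2 : Cardinal.aleph0 ≤ Module.rank ℂ H := by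
      rw [← Cardinal.lift_le, Cardinal.lift_aleph0]
      refine le_trans ?_ h1
      rw [Cardinal.aleph0_le_lift]
      exact Cardinal.aleph0_le_mk ι
    exact iff_of_true ((Cardinal.natCast_lt_aleph0).trans_le h2) (ENat.natCast_lt_top n)

variable [CompleteSpace H] {C : H →ₗ.[ℂ] H} {K W : H →L[ℂ] H} {b : HilbertBasis ι ℂ H}
  {lam : ι → ℝ} {ζ : ι → ℂ}

namespace IsEigenbasis

theorem rank_eigenspace (hC : IsSelfAdjoint C) (hK : IsResolventAt C 0 K)
    (hb : IsEigenbasis K W b lam ζ) (z : ℂ) :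
    Cardinal.toENat (Module.rank ℂ (pmapEigenspace C z)) = {i | (lam i : ℂ) = z}.encard := by
  have hval : ∀ i, b i ∈ C.domain ∧ app C (b i) = (lam i : ℂ) • b i := by
    intro i
    have h0 : (lam i : ℂ) ≠ 0 := by exact_mod_cast (hb.pos i).ne'
    have h1 : b i = (lam i : ℂ) • K (b i) := by rw [hb.inv_apply, smul_inv_smul₀ h0]
    have hd : b i ∈ C.domain := by
      rw [h1]
      exact C.domain.smul_mem _ (hK.apply_mem _)
    refine ⟨hd, ?_⟩
    conv_lhs => rw [h1]
    rw [app_smul _ (hK.apply_mem _), hK.app_apply]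
  refine toENat_rank_eq_encard b ((hb.finite z.re).subset fun i hi => ?_) (fun i hi => ?_)
    fun x hx i hi => ?_
  · have h : (lam i : ℂ) = z := hi
    simp [← h]
  · refine ⟨(hval i).1, ?_⟩
    rw [← app_eq (hval i).1, (hval i).2]
    exact congrArg (· • b i) hi
  · obtain ⟨hd, hx⟩ := hx
    rw [← app_eq hd] at hx
    have h1 := inner_app_eq_of_isSelfAdjoint hC (hval i).1 hd
    rw [(hval i).2, hx, inner_smul_left, inner_smul_right, Complex.conj_ofReal] at h1
    have h2 : ((lam i : ℂ) - z) * ⟪b i, x⟫_ℂ = 0 := by rw [sub_mul, h1, sub_self]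
    exact (mul_eq_zero.1 h2).resolve_left (sub_ne_zero.2 hi)

end IsEigenbasis

/-- The eigenvalues of `W* exp(-C)`. -/
def expEigenvalue (lam : ι → ℝ) (ζ : ι → ℂ) (i : ι) : ℂ :=
  (starRingEnd ℂ) (ζ i) * (Real.exp (-lam i) : ℂ)

omit [NormedAddCommGroup H] [InnerProductSpace ℂ H] [CompleteSpace H] in
theorem norm_expEigenvalue (hζ : ∀ i, ‖ζ i‖ = 1) (i : ι) :
    ‖expEigenvalue lam ζ i‖ = Real.exp (-lam i) := by
  rw [expEigenvalue, norm_mul, RCLike.norm_conj, hζ, one_mul, Complex.norm_real,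
    Real.norm_of_nonneg (Real.exp_nonneg _)]

namespace IsEigenbasis

omit [CompleteSpace H] in
theorem finite_expEigenvalue (hb : IsEigenbasis K W b lam ζ) (hζ : ∀ i, ‖ζ i‖ = 1) (z : ℂ) :
    {i | expEigenvalue lam ζ i = z}.Finite := by
  refine (hb.finite (-Real.log ‖z‖)).subset fun i hi => ?_
  have h : expEigenvalue lam ζ i = z := hi
  change lam i ≤ -Real.log ‖z‖
  rw [← h, norm_expEigenvalue hζ, Real.log_exp, neg_neg]

/-- `K` acts on `b i` as `1/λ`, where `expNegInvGlue` takes the value `exp(-λ)`. -/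
theorem star_mul_expNeg_apply (hC : IsSelfAdjoint C) (hK : IsResolventAt C 0 K)
    (hb : IsEigenbasis K W b lam ζ) (hW : W ∈ unitary (H →L[ℂ] H)) (i : ι) :
    (star W * expNeg K) (b i) = expEigenvalue lam ζ i • b i := by
  have h1 : expNeg K (b i) = (Real.exp (-lam i) : ℂ) • b i := by
    have hsa : IsSelfAdjoint K := (hK.isSymmetric hC).isSelfAdjoint
    have hd : Differentiable ℝ expNegInvGlue :=
      (expNegInvGlue.contDiff (n := 1)).differentiable one_ne_zero
    rw [expNeg, cfc_apply_eigenvector hsa hd (κ := (lam i)⁻¹)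
      (by rw [hb.inv_apply, Complex.ofReal_inv])]
    rw [expNegInvGlue, if_neg (not_le.2 (inv_pos.2 (hb.pos i))), inv_inv]
  change star W (expNeg K (b i)) = _
  rw [h1, map_smul, star_apply_eigenvector_unitary hW (hb.unitary_apply i), smul_smul, mul_comm]
  rfl

theorem rank_expEigenspace (hC : IsSelfAdjoint C) (hK : IsResolventAt C 0 K)
    (hb : IsEigenbasis K W b lam ζ) (hW : W ∈ unitary (H →L[ℂ] H)) (hζ : ∀ i, ‖ζ i‖ = 1) (z : ℂ) :
    Cardinal.toENat (Module.rank ℂ (pmapEigenspace (ofBounded (star W * expNeg K)) z)) =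
      {i | expEigenvalue lam ζ i = z}.encard := by
  have happ := hb.star_mul_expNeg_apply hC hK hW
  set B := star W * expNeg K
  refine toENat_rank_eq_encard b (hb.finite_expEigenvalue hζ z) (fun i hi => ?_) fun x hx i hi => ?_
  · refine ⟨trivial, ?_⟩
    change B (b i) = z • b i
    rw [happ]
    exact congrArg (· • b i) hi
  · obtain ⟨_, hx⟩ := hx
    change B x = z • x at hx
    have h1 := ((innerSL ℂ (b i)).comp B).hasSum (HilbertBasis.hasSum_inner_smul b x)
    have h2 := hasSum_single (f := fun j => ((innerSL ℂ (b i)).comp B) (⟪b j, x⟫_ℂ • b j)) i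
      fun j hj => by
        change ⟪b i, B (⟪b j, x⟫_ℂ • b j)⟫_ℂ = 0
        rw [map_smul, happ, inner_smul_right, inner_smul_right, b.orthonormal.2 hj.symm, mul_zero,
          mul_zero]
    have h3 : ⟪b i, B x⟫_ℂ = ⟪b i, B (⟪b i, x⟫_ℂ • b i)⟫_ℂ := h1.unique h2
    rw [hx, map_smul, happ, inner_smul_right, inner_smul_right, inner_smul_right,
      inner_self_eq_norm_sq_to_K, b.orthonormal.1] at h3
    have h4 : (expEigenvalue lam ζ i - z) * ⟪b i, x⟫_ℂ = 0 := by
      rw [sub_mul, h3]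
      simp [mul_comm]
    exact (mul_eq_zero.1 h4).resolve_left (sub_ne_zero.2 hi)

end IsEigenbasis

omit [NormedAddCommGroup H] [InnerProductSpace ℂ H] [CompleteSpace H] in
theorem exp_neg_eq_iff {c : ℂ} {l : ℝ} (hc : ‖c‖ = Real.exp (-l)) (z : ℂ) :
    Complex.exp (-z) = c ↔ ∃ k : ℤ, z = l - Complex.I * (c.arg + 2 * k * Real.pi) := by
  have h1 : c = Complex.exp (-(l : ℂ) + c.arg * Complex.I) := by
    conv_lhs => rw [← Complex.norm_mul_exp_arg_mul_I c, hc]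
    rw [Complex.exp_add, Complex.ofReal_exp, Complex.ofReal_neg]
  conv_lhs => rw [h1]
  rw [Complex.exp_eq_exp_iff_exists_int]
  refine exists_congr fun k => ⟨fun h => ?_, fun h => ?_⟩
  · rw [← neg_neg z, h]; ring
  · rw [h]; ring

omit [NormedAddCommGroup H] [InnerProductSpace ℂ H] [CompleteSpace H] in
-- Comparing exponentials avoids the branch of `arg`: for `ζ = -1`, the argument of `conj ζ` is not
-- `-arg ζ`, but the two agree modulo `2π`.
theorem mem_range_eigenvalue_iff (hζ : ∀ i, ‖ζ i‖ = 1) (z : ℂ) :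
    z ∈ range (fun p : ι × ℤ => (lam p.1 : ℂ) + Complex.I * frequency ζ p) ↔
      ∃ i, Complex.exp (-z) = expEigenvalue lam ζ i := by
  have key : ∀ i, expEigenvalue lam ζ i =
      Complex.exp (-((lam i : ℂ) + Complex.I * (ζ i).arg)) := by
    intro i
    have h3 := Complex.norm_mul_exp_arg_mul_I (ζ i)
    rw [hζ, Complex.ofReal_one, one_mul] at h3
    rw [expEigenvalue]
    conv_lhs => rw [← h3]
    rw [← Complex.exp_conj, Complex.ofReal_exp, ← Complex.exp_add]
    congr 1
    simp only [map_mul, Complex.conj_I, Complex.conj_ofReal]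
    push_cast
    ring
  simp only [key, Complex.exp_eq_exp_iff_exists_int]
  constructor
  · rintro ⟨⟨i, k⟩, rfl⟩
    refine ⟨i, -k, ?_⟩
    simp only [frequency]
    push_cast
    ring
  · rintro ⟨i, k, h⟩
    refine ⟨(i, -k), ?_⟩
    rw [← neg_neg z, h]
    simp only [frequency]
    push_cast
    ring

end Multiplicities

/-! ### Matching the two sorted lists -/

section Main

variable {H : Type*} [NormedAddCommGroup H] [InnerProductSpace ℂ H] [CompleteSpace H]
  {α : ℝ → ℝ} {D : Submodule ℂ H} {A Ar Ai : ℝ → H →ₗ.[ℂ] H} {C : H →ₗ.[ℂ] H}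
  {K W : H →L[ℂ] H} {ι : Type*} {b : HilbertBasis ι ℂ H} {lam : ι → ℝ} {ζ : ι → ℂ}
  {U : ℝ → ℝ → H →L[ℂ] H}

/-- One ranking by `λ` sorts both lists, because the moduli `exp(-λ)` decrease as `λ` grows. The
default values of `Function.extend` fall outside the index set and are never counted. -/
theorem exists_eigenvalueSequences (hC : IsSelfAdjoint C) (hK : IsResolventAt C 0 K)
    (hb : IsEigenbasis K W b lam ζ) (hW : W ∈ unitary (H →L[ℂ] H)) (hζ : ∀ i, ‖ζ i‖ = 1) :
    ∃ (l : ℕ → ℝ) (m : ℕ → ℂ),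
      IsEigenvalueSequence C (fun n => (l n : ℂ)) ∧ MonotoneOn l (eigenIndex H) ∧
      IsEigenvalueSequence (ofBounded (star W * expNeg K)) m ∧
      AntitoneOn (fun n => ‖m n‖) (eigenIndex H) := by
  have := hb.countable
  obtain ⟨r, hinj, hrange, hmono⟩ := exists_rank hb.finite
  rw [← eigenIndex_eq b] at hrange
  have hfiber : ∀ {X : Type} (g : ι → X) (x₀ : ℕ → X) (x : X),
      {n | n ∈ eigenIndex H ∧ Function.extend r g x₀ n = x}.encard = {i | g i = x}.encard := by
    intro X g x₀ x
    rw [← hinj.encard_image {i | g i = x}]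
    congr 1
    ext n
    rw [← hrange]
    constructor
    · rintro ⟨⟨i, rfl⟩, h⟩
      rw [hinj.extend_apply] at h
      exact ⟨i, h, rfl⟩
    · rintro ⟨i, h, rfl⟩
      exact ⟨⟨i, rfl⟩, (hinj.extend_apply _ _ _).trans h⟩
  refine ⟨Function.extend r lam 0, Function.extend r (expEigenvalue lam ζ) 0, fun z => ?_, ?_,
    fun z => ?_, ?_⟩
  · rw [hb.rank_eigenspace hC hK, ← hfiber (fun i => (lam i : ℂ)) (fun _ => 0)]
    congr 1
    ext n
    refine and_congr_right fun hn => ?_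
    rw [← hrange] at hn
    obtain ⟨i, rfl⟩ := hn
    simp only
    rw [hinj.extend_apply, hinj.extend_apply]
  · rw [← hrange]
    rintro _ ⟨i, rfl⟩ _ ⟨j, rfl⟩ hij
    rw [hinj.extend_apply, hinj.extend_apply]
    exact hmono i j hij
  · rw [hb.rank_expEigenspace hC hK hW hζ, ← hfiber (expEigenvalue lam ζ) 0]
  · rw [← hrange]
    rintro _ ⟨i, rfl⟩ _ ⟨j, rfl⟩ hij
    simp only
    rw [hinj.extend_apply, hinj.extend_apply, norm_expEigenvalue hζ, norm_expEigenvalue hζ]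
    exact Real.exp_le_exp.2 (neg_le_neg (hmono i j hij))

/-- Sorted lists of the eigenvalues of `C` and of `W* exp(-C)` correspond to each other. -/
theorem norm_eq_exp_of_sequences (hC : IsSelfAdjoint C) (hK : IsResolventAt C 0 K)
    (hb : IsEigenbasis K W b lam ζ) (hW : W ∈ unitary (H →L[ℂ] H)) (hζ : ∀ i, ‖ζ i‖ = 1)
    {l : ℕ → ℝ} {m : ℕ → ℂ} (hl : IsEigenvalueSequence C (fun n => (l n : ℂ)))
    (hlm : MonotoneOn l (eigenIndex H))
    (hm : IsEigenvalueSequence (ofBounded (star W * expNeg K)) m)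
    (hma : AntitoneOn (fun n => ‖m n‖) (eigenIndex H)) :
    (∀ n ∈ eigenIndex H, ‖m n‖ = Real.exp (-l n)) ∧
      ∃ e : eigenIndex H ≃ ι, ∀ n : eigenIndex H, expEigenvalue lam ζ (e n) = m n := by
  obtain ⟨e, he⟩ := exists_equiv_of_encard_fiber_eq (I := eigenIndex H) (f := m)
    (g := expEigenvalue lam ζ) (hb.finite_expEigenvalue hζ)
    fun z => (hm z).trans (hb.rank_expEigenspace hC hK hW hζ z)
  obtain ⟨e', he'⟩ := exists_equiv_of_encard_fiber_eq (I := eigenIndex H)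
    (f := fun n => (l n : ℂ)) (g := fun i => (lam i : ℂ))
    (fun z => (hb.finite z.re).subset fun i (hi : (lam i : ℂ) = z) => by simp [← hi])
    fun z => (hl z).trans (hb.rank_eigenspace hC hK z)
  refine ⟨?_, e, he⟩
  have hnorm : ∀ n : eigenIndex H, ‖m n‖ = Real.exp (-lam (e n)) := fun n => by
    rw [← he, norm_expEigenvalue hζ]
  -- Both `g` and `l` list the `λ_i` in increasing order, hence coincide, even though ties may let
  -- the `n`-th entries belong to different basis vectors.
  set g : ℕ → ℝ := fun n => -Real.log ‖m n‖ with hg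
  have hgv : ∀ n : eigenIndex H, g n = lam (e n) := fun n => by
    rw [hg]
    simp only
    rw [hnorm, Real.log_exp, neg_neg]
  have hlv : ∀ n : eigenIndex H, l n = lam (e' n) := fun n => by
    exact_mod_cast (he' n).symm
  have hgm : MonotoneOn g (eigenIndex H) := by
    intro i hi j hj hij
    have h1 := hma hi hj hij
    refine neg_le_neg (Real.log_le_log ?_ h1)
    rw [hnorm ⟨j, hj⟩]
    exact Real.exp_pos _
  intro n hn
  have h1 : g n ≤ l n := le_of_monotoneOn_of_comp_equiv hlm hgm (e'.trans e.symm)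
    (fun k => by rw [hgv, hlv]; simp) hn
  have h2 : l n ≤ g n := le_of_monotoneOn_of_comp_equiv hgm hlm (e.trans e'.symm)
    (fun k => by rw [hgv, hlv]; simp) hn
  rw [le_antisymm h2 h1, hgv ⟨n, hn⟩]
  exact hnorm ⟨n, hn⟩

end Main

end WeightedNormal

end

open WeightedNormal
theorem theorem9 {H : Type*} [NormedAddCommGroup H] [InnerProductSpace ℂ H] [CompleteSpace H]
    [TopologicalSpace.SeparableSpace H]
    (α : ℝ → ℝ) (D : Submodule ℂ H) (A Ar Ai : ℝ → H →ₗ.[ℂ] H) (C : H →ₗ.[ℂ] H)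
    (hA : StandingAssumptions α D A Ar Ai C)
    (U : ℝ → ℝ → H →L[ℂ] H) (hU : IsEvolutionFamily D Ai U)
    (Cinv : H →L[ℂ] H) (hCinv : IsResolventAt C 0 Cinv) (hCompact : IsCompactOperator Cinv)
    (W : H →L[ℂ] H) (hW : W ∈ unitary (H →L[ℂ] H)) (hCW : CommutesWith W C)
    (hN : IsNormalExtension (minimalOp α D A) (boundaryOp α D A (U 1 0 * W))) :
    (∃ (lam : ℕ → ℝ) (mu : ℕ → ℂ),
      IsEigenvalueSequence C (fun n => (lam n : ℂ)) ∧ MonotoneOn lam (eigenIndex H) ∧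
      IsEigenvalueSequence (ofBounded (star W * expNeg Cinv)) mu ∧
      AntitoneOn (fun n => ‖mu n‖) (eigenIndex H)) ∧
    ∀ (lam : ℕ → ℝ) (mu : ℕ → ℂ),
      IsEigenvalueSequence C (fun n => (lam n : ℂ)) → MonotoneOn lam (eigenIndex H) →
      IsEigenvalueSequence (ofBounded (star W * expNeg Cinv)) mu →
      AntitoneOn (fun n => ‖mu n‖) (eigenIndex H) →
      pmapSpectrum (boundaryOp α D A (U 1 0 * W)) =
        {z | ∃ n ∈ eigenIndex H, ∃ k : ℤ,
          z = (lam n : ℂ) - Complex.I * ((mu n).arg + 2 * k * Real.pi)} := by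
  obtain ⟨ι, b, l₀, ζ, hb⟩ := exists_isEigenbasis hA.const_selfAdjoint hA.const_nonneg hCinv
    hCompact hW hCW
  have hζ : ∀ i, ‖ζ i‖ = 1 := fun i =>
    norm_eigenvalue_unitary hW (b.orthonormal.ne_zero i) (hb.unitary_apply i)
  have hC := hA.const_selfAdjoint
  refine ⟨exists_eigenvalueSequences hC hCinv hb hW hζ, fun lam mu hlam hmono hmu hanti => ?_⟩
  obtain ⟨hnorm, e, he⟩ := norm_eq_exp_of_sequences hC hCinv hb hW hζ hlam hmono hmu hanti
  have hspec : pmapSpectrum (boundaryOp α D A (U 1 0 * W)) =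
      range fun p : ι × ℤ => (l₀ p.1 : ℂ) + Complex.I * frequency ζ p := by
    -- The proof that `α > 0` inside needs a nonzero vector; on the zero space the zero operator is
    -- a resolvent at every point, so the spectrum is empty, as is the basis.
    rcases subsingleton_or_nontrivial H with hH | hH
    · have : IsEmpty ι := ⟨fun i => b.orthonormal.ne_zero i (Subsingleton.elim _ _)⟩
      rw [range_eq_empty, eq_empty_iff_forall_notMem]
      intro z hz
      have hsub : ∀ x y : WeightedL2 H α, x = y := fun x y =>
        Lp.ext (Eventually.of_forall fun _ => Subsingleton.elim _ _)
      exact hz ⟨0, fun y => ⟨Submodule.zero_mem _, hsub _ _⟩, fun x => hsub _ _⟩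
    · exact pmapSpectrum_boundaryOp hA.isRegularWeight hA hCinv hCompact hb hU hζ hN.2
  rw [hspec]
  ext z
  rw [mem_range_eigenvalue_iff hζ]
  constructor
  · rintro ⟨i, hi⟩
    refine ⟨e.symm i, (e.symm i).2, ?_⟩
    rw [← exp_neg_eq_iff (hnorm _ (e.symm i).2), hi, ← he, e.apply_symm_apply]
  · rintro ⟨n, hn, hk⟩
    refine ⟨e ⟨n, hn⟩, ?_⟩
    rw [he ⟨n, hn⟩, exp_neg_eq_iff (hnorm n hn)]
    exact hk
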